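/- Let $\mathbb K$ be a field of characteristic zero and $\epsilon=\pm1$. Let $A1_\epsilon$ be the $\mathbb Z_2\times\mathbb Z_2$-graded color Lie algebra with basis $Q_0=H,Q_1,Q_2,Q_3$ of degrees $(0,0),(1,0),(0,1),(1,1)$, commuting factor $\epsilon(\alpha,\beta)=(-1)^{\alpha_1\beta_2-\alpha_2\beta_1}$ and brackets $[H,Q_k]=0$, $\{Q_1,Q_2\}=Q_3$, $\{Q_2,Q_3\}=\epsilon Q_1$, $\{Q_3,Q_1\}=Q_2$, so that its enveloping algebra $U(A1_\epsilon)$ is generated by the $Q_a$ subject to $Q_aQ_b=\epsilon(\deg Q_a,\deg Q_b)\,Q_bQ_a+[\![Q_a,Q_b]\!]$. Let $B=\mathrm{diag}(1,\epsilon,1,1)$ be its invariant bilinear form, $C=B^{-1}$, $c=\sum_{a,b}C^{ab}Q_aQ_b=H^2+\epsilon Q_1^2+Q_2^2+Q_3^2$ and $y=c-H^2$. For a chord diagram $D$ on an oriented circle which is cut at a point away from the endpoints and opened to an oriented line, with the chords drawn as arcs over the line, let $w(D)\in U(A1_\epsilon)$ be the value of the universal weight system: label the two feet of every arc by indices in $\{0,1,2,3\}$,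 and sum over all labellings the product of a factor $C^{ij}$ for every arc with left foot labelled $i$ and right foot labelled $j$, a factor $\epsilon(\deg Q_p,\deg Q_q)$ for every crossing of two arcs, where $p$ and $q$ are the labels of the two legs that cross, and the product of the basis elements $Q$ at the feet, taken along the line. Theorem. For every chord diagram $D$ and every cutting point, $w(D)$ is a polynomial in $c$ and $y$ with coefficients in $\mathbb K$. Moreover, let $a$ be any chord of $D$ and let $b_1,\dots,b_k$ be the chords of $D$ which intersect $a$. Then, all diagrams being cut at the same point, $$w(D)=(c-\epsilon k)\,w(D_a)+\epsilon(c-y)\sum_i w(D_{a,i})+\epsilon\sum_{i<j}\bigl(w(D_{a,ij}^{\parallel})-w(D_{a,ij}^{\times})\bigr)+\epsilon(c-y)\sum_{i<j}\bigl(w(D_{a,ij}^{\ell r})+w(D_{a,ij}^{r\ell})-w(D_{a,ij}^{\ell\ell})-w(D_{a,ij}^{rr})\bigr).$$ Here $D_a=D-a$, $D_{a,i}=D-a-b_i$ and $D_{a,ij}=D-a-b_i-b_j$. Draw $D$ with $a$ vertical, so that each $b_i$ has a left end and a right end. The diagrams with a superscript arise from $D_{a,ij}$ by adding the following new chords: for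 $\parallel$, one joining the left ends of $b_i$ and $b_j$ and one joining their right ends; for $\times$, one joining the left end of $b_i$ with the right end of $b_j$ and one joining the right end of $b_i$ with the left end of $b_j$; for $\ell r$, only one joining the left end of $b_i$ with the right end of $b_j$; for $r\ell$, only one joining the right end of $b_i$ with the left end of $b_j$; for $\ell\ell$, only one joining the two left ends; for $rr$, only one joining the two right ends. -/

import Mathlib

/-! ## Chord diagrams on an oriented circle -/

/-- A chord diagram on the oriented circle carrying `N` marked points, in the cyclic order of
`Fin N`. It is an involution `mate` of the marked points: `x` is an endpoint of a chord iff
`mate x ≠ x`, the chord then being `{x, mate x}`; fixed points of `mate` are marked points which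
carry no chord (and which play no role). The diagrams with `n` chords are those with `2 * n`
non-fixed points. -/
structure ChordDiagram (N : ℕ) where
  mate : Equiv.Perm (Fin N)
  involutive : ∀ x, mate (mate x) = x

namespace ChordDiagram

variable {N : ℕ}

theorem swap_mate_involutive (D : ChordDiagram N) (x y : Fin N)
    (h : D.mate x = y ∨ (D.mate x = x ∧ D.mate y = y)) (z : Fin N) :
    (D.mate * Equiv.swap x y) ((D.mate * Equiv.swap x y) z) = z := by
  have hi := D.involutive
  have hinj := D.mate.injective
  simp only [Equiv.Perm.mul_apply]
  rcases h with rfl | ⟨hx, hy⟩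
  · by_cases h1 : z = x
    · subst h1; simp [hi]
    · by_cases h2 : z = D.mate x
      · subst h2; simp
      · rw [Equiv.swap_apply_of_ne_of_ne h1 h2, Equiv.swap_apply_of_ne_of_ne, hi]
        · intro h; exact h2 (by rw [← h, hi])
        · intro h; exact h1 (hinj h)
  · by_cases h1 : z = x
    · subst h1; simp [hx, hy]
    · by_cases h2 : z = y
      · subst h2; simp [hx, hy]
      · rw [Equiv.swap_apply_of_ne_of_ne h1 h2, Equiv.swap_apply_of_ne_of_ne, hi]
        · intro h; exact h1 (hinj (h.trans hx.symm))
        · intro h; exact h2 (hinj (h.trans hy.symm))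

/-- Delete the chord that ends at `x` (nothing happens if no chord ends at `x`). -/
def erase (D : ChordDiagram N) (x : Fin N) : ChordDiagram N where
  mate := D.mate * Equiv.swap x (D.mate x)
  involutive := D.swap_mate_involutive x (D.mate x) (Or.inl rfl)

theorem erase_mate_self (D : ChordDiagram N) (x : Fin N) : (D.erase x).mate x = x := by
  simp [erase, D.involutive]

theorem erase_mate_of_fixed (D : ChordDiagram N) (x y : Fin N) (h : D.mate y = y) :
    (D.erase x).mate y = y := by
  by_cases h1 : y = x
  · subst h1; exact D.erase_mate_self y
  · have h2 : y ≠ D.mate x := fun e => h1 (D.mate.injective (by rw [h]; exact e))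
    simp [erase, Equiv.swap_apply_of_ne_of_ne h1 h2, h]

/-- Add a chord connecting the marked points `x` and `y`. (If chords already end at `x` or at `y`
they are deleted first; below this is only used for points that carry no chord.) -/
def join (D : ChordDiagram N) (x y : Fin N) : ChordDiagram N where
  mate := ((D.erase x).erase y).mate * Equiv.swap x y
  involutive := ((D.erase x).erase y).swap_mate_involutive x y
    (Or.inr ⟨erase_mate_of_fixed _ y x (D.erase_mate_self x), erase_mate_self _ y⟩)

/-- The diagram read from another base point: the marked point `x` becomes the marked point
`x + p` (cyclically). -/
def rotate (p : ℕ) (D : ChordDiagram N) : ChordDiagram N where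
  mate := (finRotate N ^ p) * D.mate * (finRotate N ^ p)⁻¹
  involutive := fun x => by simp [D.involutive]

/-- Draw the chord `a` through the point `a` vertically, with `a` as one end and `D.mate a` as the
other end. The points to the left of it are those met when one travels along the oriented circle
from `a` to `D.mate a`. -/
def IsLeft (D : ChordDiagram N) (a x : Fin N) : Prop := sbtw a x (D.mate a)

/-- The points to the right of the chord `a`: those met when one travels along the oriented circle
from `D.mate a` to `a`. -/
def IsRight (D : ChordDiagram N) (a x : Fin N) : Prop := sbtw (D.mate a) x a

instance (D : ChordDiagram N) (a x : Fin N) : Decidable (D.IsLeft a x) :=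
  inferInstanceAs (Decidable (a < x ∧ x < D.mate a ∨ x < D.mate a ∧ D.mate a < a ∨
    D.mate a < a ∧ a < x))

instance (D : ChordDiagram N) (a x : Fin N) : Decidable (D.IsRight a x) :=
  inferInstanceAs (Decidable (D.mate a < x ∧ x < a ∨ x < a ∧ a < D.mate a ∨
    a < D.mate a ∧ D.mate a < x))

/-- The set of the left ends of the chords which intersect the chord `a`. It is in bijection with
the set of these chords; the right end of the chord with left end `b` is `D.mate b`. -/
def crossing (D : ChordDiagram N) (a : Fin N) : Finset (Fin N) :=
  Finset.univ.filter fun b => D.IsLeft a b ∧ D.IsRight a (D.mate b)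

end ChordDiagram

/-! ## The color Lie algebra `A1_ε` -/

namespace A1

/-- The degrees in `ℤ₂ × ℤ₂` of the basis `H = Q₀, Q₁, Q₂, Q₃`. -/
def deg : Fin 4 → ZMod 2 × ZMod 2 := ![(0, 0), (1, 0), (0, 1), (1, 1)]

/-- The commuting factor `(-1)^(α₁β₂ - α₂β₁)` on `ℤ₂ × ℤ₂`. -/
def commFactor (K : Type*) [Field K] (α β : ZMod 2 × ZMod 2) : K :=
  (-1) ^ (α.1 * β.2 - α.2 * β.1).val

/-- The coefficient `S_{ij}^{kl}` of `Q_k ⊗ Q_l` in `S(Q_i, Q_j) = ε(deg Q_i, deg Q_j) Q_j ⊗ Q_i`,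
where `ε(·,·)` is the commuting factor. -/
def S (K : Type*) [Field K] (i j k l : Fin 4) : K :=
  if k = j ∧ l = i then commFactor K (deg i) (deg j) else 0

/-- The coefficients of `⟦Q_i, Q_j⟧` in the basis `Q₀, Q₁, Q₂, Q₃`:
`⟦Q₁, Q₂⟧ = Q₃`, `⟦Q₂, Q₃⟧ = ε Q₁`, `⟦Q₃, Q₁⟧ = Q₂`, the bracket being symmetric on these pairs
(it is an anticommutator), and all other brackets of basis elements vanish. -/
def bracket {K : Type*} [Field K] (ε : K) : Fin 4 → Fin 4 → Fin 4 → K :=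
  ![![0, 0, 0, 0],
    ![0, 0, ![0, 0, 0, 1], ![0, 0, 1, 0]],
    ![0, ![0, 0, 0, 1], 0, ![0, ε, 0, 0]],
    ![0, ![0, 0, 1, 0], ![0, ε, 0, 0], 0]]

/-- The defining relations `Q_i Q_j = S(Q_i, Q_j) + ⟦Q_i, Q_j⟧` of the enveloping algebra. -/
inductive Rel {K : Type*} [Field K] (ε : K) :
    FreeAlgebra K (Fin 4) → FreeAlgebra K (Fin 4) → Prop
  | mk (i j : Fin 4) : Rel ε (FreeAlgebra.ι K i * FreeAlgebra.ι K j)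
      ((∑ k, ∑ l, S K i j k l • (FreeAlgebra.ι K k * FreeAlgebra.ι K l)) +
        ∑ k, bracket ε i j k • FreeAlgebra.ι K k)

/-- The universal enveloping algebra `U(A1_ε)`: the tensor algebra of the four-dimensional space
with basis `Q₀, Q₁, Q₂, Q₃` (that is, the free algebra on the basis) modulo the relations. -/
abbrev U {K : Type*} [Field K] (ε : K) : Type _ := RingQuot (Rel ε)

/-- The basis element `Q_i` of `A1_ε` in the enveloping algebra. -/
noncomputable def Q {K : Type*} [Field K] (ε : K) (i : Fin 4) : U ε :=
  RingQuot.mkAlgHom K (Rel ε) (FreeAlgebra.ι K i)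

/-- The invariant bilinear form of `A1_ε` in the basis `Q₀, Q₁, Q₂, Q₃`. -/
def B {K : Type*} [Field K] (ε : K) : Matrix (Fin 4) (Fin 4) K := Matrix.diagonal ![1, ε, 1, 1]

/-- The inverse `C^{ij}` of the invariant bilinear form. -/
noncomputable def C {K : Type*} [Field K] (ε : K) : Matrix (Fin 4) (Fin 4) K := (B ε)⁻¹

/-- The Casimir element `c = ∑ C^{ij} Q_i Q_j`. -/
noncomputable def c {K : Type*} [Field K] (ε : K) : U ε := ∑ i, ∑ j, C ε i j • (Q ε i * Q ε j)

/-- The central element `y = c - H²`. -/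
noncomputable def y {K : Type*} [Field K] (ε : K) : U ε := c ε - Q ε 0 ^ 2

/-- The value of the universal weight system on a diagram `D`, the circle being cut between the last
and the first marked point and opened to a line, and the chords being drawn as arcs over the line.
Every endpoint `x` is labelled by the index `φ x` of a basis element (points without chord get the
dummy label `0`), and one sums over all labellings the product of
* the constant `C^{ij}` for every arc, where `i` and `j` are the labels of its left and right foot;
* the constant `S_{pq}^{qp}` for every crossing of two arcs, in which the right leg (label `p`) of
  the arc from `x` to `mate x` crosses the left leg (label `q`) of the arc from `z` to `mate z`,
  where `x < z < mate x < mate z` (the other `S_{pq}^{jk}` are zero, so the label of a leg does not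
  change at a crossing);
* the product in `U(A1_ε)` of the basis elements at the endpoints, along the line. -/
noncomputable def linearWeight {K : Type*} [Field K] (ε : K) {N : ℕ} (D : ChordDiagram N) : U ε :=
  ∑ φ : Fin N → Fin 4 with ∀ x, D.mate x = x → φ x = 0,
    ((∏ x : Fin N with x < D.mate x, C ε (φ x) (φ (D.mate x))) *
      ∏ e : Fin N × Fin N with
          e.1 < e.2 ∧ e.2 < D.mate e.1 ∧ D.mate e.1 < D.mate e.2,
        S K (φ (D.mate e.1)) (φ e.2) (φ e.2) (φ (D.mate e.1))) •
      ((List.finRange N).map fun x => if D.mate x = x then 1 else Q ε (φ x)).prod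

/-- The universal `A1_ε` weight system for framed knots, on chord diagrams whose circle is cut at
the place given by `p`: after the cyclic shift of the marked points by `p`, the cut is between the
last and the first marked point. All places of the cut arise in this way. -/
noncomputable def w {K : Type*} [Field K] (ε : K) (p : ℕ) {N : ℕ} (D : ChordDiagram N) : U ε :=
  linearWeight ε (D.rotate p)

/-- `D_{a,ij}`: the diagram `D` without the chords through the points `a`, `i`, `j`. -/
def erase₃ {N : ℕ} (D : ChordDiagram N) (a i j : Fin N) : ChordDiagram N :=
  ((D.erase a).erase i).erase j

end A1

/-! ## Surgery on chord diagrams -/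

namespace ChordDiagram

variable {N : ℕ}

/-! The commuting factor is the antisymmetrization of the bicharacter `cocycle`, so the colour can
be twisted away. The matrices `twist K α` multiply with exactly this cocycle, and the elements `Q_i
⊗ twist (deg i)` of `U ε ⊗ M₂(K)` span an ordinary Lie algebra: a three-dimensional one of type sl₂
plus the centre spanned by `H ⊗ 1`. In the ordered product of the letters the cocycles collect into
one sign per crossing and one sign per chord. The first are the crossing factors of the colour
weight, the second turn the form `C` into `diag(1, ε, 1, -1)`. Hence `w(D) ⊗ 1` is an ordinary Lie
algebra weight (`untwist_linearWeight`), and since `u ↦ u ⊗ 1` is injective it suffices to treat the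
latter.

There the argument is that of the Chmutov–Varchenko recursion for sl₂. If `v` is the part of the
word between the ends of `a`, then `2xvx = x²v + vx² - [x,[x,v]]`. Summed over the labels of `a`,
the first two terms give twice the Casimir element times the weight of `D - a`. By the Leibniz rule
the double commutator is a sum of `pair p q` over points `p`, `q` between the ends of `a`.
Invariance of the form gives `pair p q = -pair (mate p) q`, so only chords crossing `a` survive
(`sum_pair_Ioo`). For `p = q` the operator is the Casimir operator of the adjoint representation,
equal to `2ε` on the sl₂ part and to `0` on the centre (`pair_self`). For different chords the
contraction identity of the vector product (`exchange`) replaces the two chords by the parallel pair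
minus the crossed pair (`pair_of_separate`). In both cases the restriction to the sl₂ part is undone
by subtracting labels `0`, which is where `H² = c - y` enters. The sum over ordered pairs is
symmetric, and division by `2` gives the formula.

Every diagram on the right of the recursion has its chord ends among those of `D`, without the ends
of `a`. Induction on the number of ends gives polynomiality in the commuting elements `c` and `y`.
-/

theorem ext_mate {D E : ChordDiagram N} (h : ∀ z, D.mate z = E.mate z) : D = E := by
  cases D; cases E; congr 1; exact Equiv.ext h

theorem erase_mate (D : ChordDiagram N) (x z : Fin N) :
    (D.erase x).mate z = if z = x ∨ z = D.mate x then z else D.mate z := by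
  have hi := D.involutive
  split_ifs with h
  · rcases h with rfl | rfl <;> simp [erase, hi]
  · push Not at h
    simp [erase, Equiv.swap_apply_of_ne_of_ne h.1 h.2]

theorem erase_of_fixed (D : ChordDiagram N) {x : Fin N} (h : D.mate x = x) : D.erase x = D := by
  apply ext_mate; intro z
  rw [erase_mate, h]
  split_ifs with hz
  · rcases hz with rfl | rfl <;> exact h.symm
  · rfl

theorem erase_of_mate (D : ChordDiagram N) (x : Fin N) : D.erase (D.mate x) = D.erase x := by
  apply ext_mate; intro z
  simp only [erase_mate, D.involutive, or_comm]

theorem join_mate (D : ChordDiagram N) {x y : Fin N} (hx : D.mate x = x) (hy : D.mate y = y)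
    (z : Fin N) :
    (D.join x y).mate z = if z = x then y else if z = y then x else D.mate z := by
  have : (D.join x y).mate z = D.mate (Equiv.swap x y z) := by
    simp only [join]
    rw [D.erase_of_fixed hx, D.erase_of_fixed hy]; rfl
  rw [this]
  split_ifs with h1 h2
  · subst h1; simp [hy]
  · subst h2; simp [hx]
  · rw [Equiv.swap_apply_of_ne_of_ne h1 h2]

theorem join_comm (D : ChordDiagram N) {x y : Fin N} (hx : D.mate x = x) (hy : D.mate y = y) :
    D.join x y = D.join y x := by
  apply ext_mate; intro z
  rw [join_mate D hx hy, join_mate D hy hx]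
  split_ifs <;> simp_all

theorem join_join_comm (D : ChordDiagram N) {x y z t : Fin N} (hx : D.mate x = x)
    (hy : D.mate y = y) (hz : D.mate z = z) (ht : D.mate t = t)
    (hxz : x ≠ z) (hxt : x ≠ t) (hyz : y ≠ z) (hyt : y ≠ t) :
    (D.join x y).join z t = (D.join z t).join x y := by
  have h1 : (D.join x y).mate z = z := by rw [join_mate D hx hy]; simp [hxz.symm, hyz.symm, hz]
  have h2 : (D.join x y).mate t = t := by rw [join_mate D hx hy]; simp [hxt.symm, hyt.symm, ht]
  have h3 : (D.join z t).mate x = x := by rw [join_mate D hz ht]; simp [hxz, hxt, hx]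
  have h4 : (D.join z t).mate y = y := by rw [join_mate D hz ht]; simp [hyz, hyt, hy]
  apply ext_mate; intro w
  rw [join_mate _ h1 h2, join_mate _ h3 h4, join_mate _ hx hy, join_mate _ hz ht]
  split_ifs <;> simp_all

theorem join_erase (D : ChordDiagram N) (x : Fin N) : (D.erase x).join x (D.mate x) = D := by
  have hi := D.involutive
  apply ext_mate; intro z
  rw [join_mate _ (by simp [erase_mate]) (by simp [erase_mate])]
  split_ifs with h1 h2
  · rw [h1]
  · rw [h2, hi]
  · simp [erase_mate, h1, h2]

theorem erase_comm (D : ChordDiagram N) (x y : Fin N) :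
    (D.erase x).erase y = (D.erase y).erase x := by
  have hi := D.involutive
  by_cases hxy : y = x
  · rw [hxy]
  by_cases hxy' : y = D.mate x
  · subst hxy'
    rw [D.erase_of_mate, erase_of_fixed (D.erase x) (x := D.mate x) (by simp [erase_mate]),
      erase_of_fixed (D.erase x) (D.erase_mate_self x)]
  have hxy'' : x ≠ D.mate y := fun h => hxy' (by rw [h, hi])
  apply ext_mate; intro z
  have h1 : (D.erase x).mate y = D.mate y := by rw [erase_mate, if_neg (by tauto)]
  have h2 : (D.erase y).mate x = D.mate x := by rw [erase_mate, if_neg]; tauto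
  rw [erase_mate (D.erase x) y, erase_mate (D.erase y) x, h1, h2, erase_mate, erase_mate]
  split_ifs <;> tauto

/-- Two points are ends of different chords. -/
structure Separate (D : ChordDiagram N) (x y : Fin N) : Prop where
  ne : x ≠ y
  ne_mate : x ≠ D.mate y

theorem Separate.symm {D : ChordDiagram N} {x y : Fin N} (h : D.Separate x y) :
    D.Separate y x :=
  ⟨h.ne.symm, fun e => h.ne_mate (by rw [e, D.involutive])⟩

theorem Separate.mate_left {D : ChordDiagram N} {x y : Fin N} (h : D.Separate x y) :
    D.Separate (D.mate x) y :=
  ⟨fun e => h.ne_mate (by rw [← e, D.involutive]), fun e => h.ne (D.mate.injective e)⟩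

theorem Separate.mate_right {D : ChordDiagram N} {x y : Fin N} (h : D.Separate x y) :
    D.Separate x (D.mate y) :=
  h.symm.mate_left.symm

theorem Separate.erase_mate {D : ChordDiagram N} {x y : Fin N} (h : D.Separate x y) :
    (D.erase y).mate x = D.mate x := by
  rw [ChordDiagram.erase_mate, if_neg]
  rintro (e | e)
  exacts [h.ne e, h.ne_mate e]

/-- The same diagram after relabelling the marked points by a permutation. -/
def conj (σ : Equiv.Perm (Fin N)) (D : ChordDiagram N) : ChordDiagram N where
  mate := σ * D.mate * σ⁻¹
  involutive := fun x => by simp [D.involutive]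

theorem rotate_eq_conj (p : ℕ) (D : ChordDiagram N) : D.rotate p = D.conj (finRotate N ^ p) := rfl

theorem conj_mate (σ : Equiv.Perm (Fin N)) (D : ChordDiagram N) (x : Fin N) :
    (D.conj σ).mate (σ x) = σ (D.mate x) := by simp [conj]

theorem conj_erase (σ : Equiv.Perm (Fin N)) (D : ChordDiagram N) (x : Fin N) :
    (D.erase x).conj σ = (D.conj σ).erase (σ x) := by
  apply ext_mate; intro z
  obtain ⟨z, rfl⟩ := σ.surjective z
  rw [conj_mate, erase_mate, erase_mate, conj_mate, conj_mate]
  simp only [σ.injective.eq_iff]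
  split_ifs <;> rfl

theorem conj_join (σ : Equiv.Perm (Fin N)) (D : ChordDiagram N) (x y : Fin N) :
    (D.join x y).conj σ = (D.conj σ).join (σ x) (σ y) := by
  apply ext_mate; intro z
  obtain ⟨z, rfl⟩ := σ.surjective z
  have : ∀ (E : ChordDiagram N) (u v t : Fin N),
      (E.join u v).mate t = ((E.erase u).erase v).mate (Equiv.swap u v t) := fun _ _ _ _ => rfl
  rw [conj_mate, this, this, ← conj_erase, ← conj_erase, ← conj_mate]
  congr 1
  simp only [Equiv.swap_apply_def, σ.injective.eq_iff]
  split_ifs <;> rfl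

theorem sbtw_iff (x y z : Fin N) :
    sbtw x y z ↔ (x < y ∧ y < z ∨ y < z ∧ z < x ∨ z < x ∧ x < y) := Iff.rfl

/-- The sides of a chord depend only on the cyclic order, so invariance under rotation reduces an
arbitrary cut to the standard one. -/
theorem sbtw_finRotate (x y z : Fin N) :
    sbtw (finRotate N x) (finRotate N y) (finRotate N z) ↔ sbtw x y z := by
  rcases N with _ | n
  · exact x.elim0
  simp only [sbtw_iff, Fin.lt_def, coe_finRotate, Fin.ext_iff, Fin.val_last]
  have := x.2; have := y.2; have := z.2
  split_ifs <;> omega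

theorem sbtw_finRotate_pow (p : ℕ) (x y z : Fin N) :
    sbtw ((finRotate N ^ p) x) ((finRotate N ^ p) y) ((finRotate N ^ p) z) ↔ sbtw x y z := by
  induction p with
  | zero => simp
  | succ p ih => simpa only [pow_succ', Equiv.Perm.mul_apply, sbtw_finRotate] using ih

theorem mem_crossing {D : ChordDiagram N} {a x : Fin N} :
    x ∈ D.crossing a ↔ sbtw a x (D.mate a) ∧ sbtw (D.mate a) (D.mate x) a := by
  rw [crossing, Finset.mem_filter, IsLeft, IsRight]
  simp only [Finset.mem_univ, true_and]

theorem crossing_rotate (p : ℕ) (D : ChordDiagram N) (a : Fin N) :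
    (D.rotate p).crossing ((finRotate N ^ p) a) =
      (D.crossing a).map (finRotate N ^ p).toEmbedding := by
  ext z
  obtain ⟨z, rfl⟩ := (finRotate N ^ p).surjective z
  simp only [mem_crossing, rotate_eq_conj, conj_mate, sbtw_finRotate_pow, Finset.mem_map_equiv, Equiv.symm_apply_apply]

/-- Reading `a` from its other end exchanges left and right, hence the two ends of each crossing
chord. -/
theorem crossing_mate (D : ChordDiagram N) (a : Fin N) :
    D.crossing (D.mate a) = (D.crossing a).map D.mate.toEmbedding := by
  ext z
  obtain ⟨z, rfl⟩ := D.mate.surjective z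
  simp only [mem_crossing, Finset.mem_map_equiv, Equiv.symm_apply_apply, D.involutive]
  tauto

theorem ne_of_mem_crossing {D : ChordDiagram N} {a x : Fin N} (h : x ∈ D.crossing a) :
    D.mate x ≠ x ∧ D.Separate x a := by
  simp only [mem_crossing, sbtw_iff] at h
  refine ⟨fun e => ?_, fun e => ?_, fun e => ?_⟩
  · rw [e] at h; omega
  · rw [e] at h; omega
  · rw [← e] at h; omega

theorem separate_of_mem_crossing {D : ChordDiagram N} {a x y : Fin N} (hx : x ∈ D.crossing a)
    (hy : y ∈ D.crossing a) (hxy : x ≠ y) : D.Separate x y := by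
  refine ⟨hxy, fun e => ?_⟩
  simp only [mem_crossing, sbtw_iff] at hx hy
  rw [← e] at hy
  omega

/-- When the cut lies to the right of `a`, the left side is an interval of the line, hence a factor
of the word. -/
theorem mem_crossing_of_lt {D : ChordDiagram N} {a x : Fin N} (h : a < D.mate a) :
    x ∈ D.crossing a ↔ D.mate x ≠ x ∧ x ∈ Finset.Ioo a (D.mate a) ∧
      D.mate x ∉ Finset.Ioo a (D.mate a) := by
  have hi := D.involutive
  have h1 : x = a → D.mate x = D.mate a := fun e => by rw [e]
  have h2 : D.mate x = a → x = D.mate a := fun e => by rw [← e, hi]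
  have h3 : D.mate x = D.mate a → x = a := fun e => D.mate.injective e
  simp only [mem_crossing, sbtw_iff, Finset.mem_Ioo]
  omega

end ChordDiagram

/-! ## Sums over labellings in an algebra generated by a metric Lie algebra -/

namespace A1

open Finset Function ChordDiagram

/-- Four elements of an algebra, the first one central, that span a Lie algebra under the commutator,
with an invariant diagonal form whose structure constants satisfy the relations of
`𝔤𝔩₂ = 𝔰𝔩₂ ⊕ 𝔤𝔩₁`. -/
structure LieFrame {K : Type*} [Field K] (ε : K) (A : Type*) [Ring A] [Algebra K A] where
  X : Fin 4 → A
  f : Fin 4 → Fin 4 → Fin 4 → K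
  g : Fin 4 → K
  lie : ∀ k m, X k * X m - X m * X k = ∑ n, f k m n • X n
  g_zero : g 0 = 1
  f_zero : ∀ k n, f k 0 n = 0
  invariant : ∀ k m n, g m * f k m n + g n * f k n m = 0
  casimir : ∀ m l, ∑ k, ∑ n, g k * (f k m n * f k n l) = if m = l ∧ m ≠ 0 then 2 * ε else 0
  -- The identity `ε_{kmi} ε_{knj} = δ_{mn} δ_{ij} - δ_{in} δ_{mj}` of the vector product,
  -- restricted to the nonzero indices and weighted by the form.
  exchange : ∀ m n i j, ∑ k, g k * g m * g n * (f k m i * f k n j) =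
    -ε * ((if i = j ∧ i ≠ 0 ∧ m = n ∧ m ≠ 0 then g i * g m else 0) -
      if i = n ∧ i ≠ 0 ∧ j = m ∧ j ≠ 0 then g i * g j else 0)

variable {K : Type*} [Field K] {ε : K} {A : Type*} [Ring A] [Algebra K A]

/-- The commutator with `x`. -/
def ad (x : A) : A →ₗ[K] A := LinearMap.mulLeft K x - LinearMap.mulRight K x

theorem ad_apply (x z : A) : ad (K := K) x z = x * z - z * x := by simp [ad]

/-- The product along the line. -/
noncomputable abbrev word (K : Type*) [Field K] (N : ℕ) (A : Type*) [Ring A] [Algebra K A] :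
    MultilinearMap K (fun _ : Fin N => A) A :=
  MultilinearMap.mkPiAlgebraFin K N A

theorem word_apply {N : ℕ} (ψ : Fin N → A) : word K N A ψ = ((List.finRange N).map ψ).prod := by
  rw [word, MultilinearMap.mkPiAlgebraFin_apply, List.ofFn_eq_map]

/-- Take the commutator with `x` in the argument at `p` first. -/
noncomputable def derivAt {N : ℕ} (x : A) (p : Fin N) (G : MultilinearMap K (fun _ : Fin N => A) A) :
    MultilinearMap K (fun _ : Fin N => A) A :=
  G.compLinearMap (update (fun _ => LinearMap.id) p (ad x))

theorem derivAt_apply {N : ℕ} (x : A) (p : Fin N) (G : MultilinearMap K (fun _ : Fin N => A) A)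
    (ψ : Fin N → A) : derivAt x p G ψ = G (update ψ p (x * ψ p - ψ p * x)) := by
  rw [derivAt, MultilinearMap.compLinearMap_apply]
  congr 1
  ext z
  by_cases h : z = p
  · subst h; simp [ad_apply]
  · simp [h]

theorem derivAt_comm {N : ℕ} (x : A) (p q : Fin N) (G : MultilinearMap K (fun _ : Fin N => A) A) :
    derivAt x p (derivAt x q G) = derivAt x q (derivAt x p G) := by
  by_cases h : p = q
  · rw [h]
  ext ψ
  simp only [derivAt_apply, update_of_ne h, update_of_ne (Ne.symm h)]
  rw [update_comm h]

theorem derivAt_of_eq_one {N : ℕ} (x : A) (p : Fin N)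
    (G : MultilinearMap K (fun _ : Fin N => A) A) (ψ : Fin N → A) (h : ψ p = 1) :
    derivAt x p G ψ = 0 := by
  rw [derivAt_apply, h, mul_one, one_mul, sub_self]
  exact G.map_update_zero ψ p

namespace LieFrame

variable (L : LieFrame ε A) {N : ℕ}

/-- The labellings of the chords of `D`. -/
def labellings (D : ChordDiagram N) : Finset (Fin N → Fin 4) :=
  univ.filter fun φ => (∀ x, D.mate x = x → φ x = 0) ∧ ∀ x, φ (D.mate x) = φ x

theorem mem_labellings {D : ChordDiagram N} {φ : Fin N → Fin 4} :
    φ ∈ labellings D ↔ (∀ x, D.mate x = x → φ x = 0) ∧ ∀ x, φ (D.mate x) = φ x := by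
  simp [labellings]

/-- The product of the form over the chords. -/
def chordProd (D : ChordDiagram N) (φ : Fin N → Fin 4) : K :=
  ∏ x with x < D.mate x, L.g (φ x)

/-- The elements at the marked points. -/
def letters (D : ChordDiagram N) (φ : Fin N → Fin 4) (x : Fin N) : A :=
  if D.mate x = x then 1 else L.X (φ x)

/-- The sum over all labellings of the chords of `D` of the value of `G`. -/
def contract (D : ChordDiagram N) (G : (Fin N → A) → A) : A :=
  ∑ φ ∈ labellings D, L.chordProd D φ • G (L.letters D φ)

theorem letters_of_fixed {D : ChordDiagram N} {x : Fin N} (h : D.mate x = x) (φ : Fin N → Fin 4) :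
    L.letters D φ x = 1 := if_pos h

theorem contract_congr {D : ChordDiagram N} {G G' : (Fin N → A) → A}
    (h : ∀ φ, G (L.letters D φ) = G' (L.letters D φ)) : L.contract D G = L.contract D G' :=
  Finset.sum_congr rfl fun φ _ => by rw [h]

theorem contract_sum {ι : Type*} (s : Finset ι) (D : ChordDiagram N) (G : ι → (Fin N → A) → A) :
    L.contract D (fun ψ => ∑ i ∈ s, G i ψ) = ∑ i ∈ s, L.contract D (G i) := by
  simp only [contract, Finset.smul_sum]
  exact Finset.sum_comm

theorem contract_smul (r : K) (D : ChordDiagram N) (G : (Fin N → A) → A) :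
    L.contract D (fun ψ => r • G ψ) = r • L.contract D G := by
  simp only [contract, Finset.smul_sum]
  exact Finset.sum_congr rfl fun φ _ => smul_comm _ _ _

theorem contract_sub (D : ChordDiagram N) (G G' : (Fin N → A) → A) :
    L.contract D (fun ψ => G ψ - G' ψ) = L.contract D G - L.contract D G' := by
  simp only [contract, smul_sub, Finset.sum_sub_distrib]

theorem contract_mul_left (z : A) (D : ChordDiagram N) (G : (Fin N → A) → A) :
    L.contract D (fun ψ => z * G ψ) = z * L.contract D G := by
  simp only [contract, Finset.mul_sum, mul_smul_comm]

theorem contract_zero (D : ChordDiagram N) : L.contract D (fun _ => 0) = 0 := by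
  simp [contract]

theorem chordProd_join {D : ChordDiagram N} {x y : Fin N} (hx : D.mate x = x) (hy : D.mate y = y)
    (hxy : x ≠ y) (φ : Fin N → Fin 4) (m : Fin 4) :
    L.chordProd (D.join x y) (update (update φ x m) y m) = L.g m * L.chordProd D φ := by
  -- Here `t` is the smaller of `x` and `y`, the foot at which the new chord is counted.
  have key : ∀ t : Fin N, (t = x ∨ t = y) → (univ.filter fun z => z < (D.join x y).mate z) =
      insert t (univ.filter fun z => z < D.mate z) →
      L.chordProd (D.join x y) (update (update φ x m) y m) = L.g m * L.chordProd D φ := by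
    intro t ht h
    rw [chordProd, h, prod_insert, chordProd]
    · congr 1
      · rcases ht with rfl | rfl
        · rw [update_of_ne hxy, update_self]
        · rw [update_self]
      · refine prod_congr rfl fun z hz => ?_
        have hz' := (mem_filter.1 hz).2
        rw [update_of_ne, update_of_ne]
        · rintro rfl; rw [hx] at hz'; exact lt_irrefl _ hz'
        · rintro rfl; rw [hy] at hz'; exact lt_irrefl _ hz'
    · rcases ht with rfl | rfl <;> simp [hx, hy]
  rcases lt_or_gt_of_ne hxy with h | h
  · refine key x (Or.inl rfl) ?_
    ext z
    simp only [mem_filter, mem_univ, true_and, mem_insert, join_mate D hx hy]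
    split_ifs with h1 h2
    · subst h1; simp [h]
    · subst h2; simp [h1, hy, h.le]
    · simp [h1]
  · refine key y (Or.inr rfl) ?_
    ext z
    simp only [mem_filter, mem_univ, true_and, mem_insert, join_mate D hx hy]
    split_ifs with h1 h2
    · subst h1; simp [hxy, hx, h.le]
    · subst h2; simp [h]
    · simp [h2]

theorem letters_join {D : ChordDiagram N} {x y : Fin N} (hx : D.mate x = x) (hy : D.mate y = y)
    (hxy : x ≠ y) (φ : Fin N → Fin 4) (m : Fin 4) :
    L.letters (D.join x y) (update (update φ x m) y m) =
      update (update (L.letters D φ) x (L.X m)) y (L.X m) := by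
  ext z
  rw [letters, join_mate D hx hy]
  by_cases h1 : z = x
  · subst h1; simp [hxy, hxy.symm]
  · by_cases h2 : z = y
    · subst h2; simp [hxy, h1]
    · simp [h1, h2, letters]

/-- The sum over the labels of one chord. -/
theorem contract_join {D : ChordDiagram N} {x y : Fin N} (hx : D.mate x = x) (hy : D.mate y = y)
    (hxy : x ≠ y) (G : (Fin N → A) → A) :
    L.contract (D.join x y) G = ∑ m, L.g m •
      L.contract D (fun ψ => G (update (update ψ x (L.X m)) y (L.X m))) := by
  simp only [contract, Finset.smul_sum]
  rw [← Finset.sum_product' (f := fun m φ => L.g m • L.chordProd D φ •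
    G (update (update (L.letters D φ) x (L.X m)) y (L.X m)))]
  symm
  -- A labelling of the larger diagram is one label for the new chord and a labelling of the rest;
  -- the inverse resets `x` and `y` to the dummy label `0` that points without chord must carry.
  refine Finset.sum_nbij' (fun u : Fin 4 × (Fin N → Fin 4) => update (update u.2 x u.1) y u.1)
    (fun φ => (φ x, update (update φ x 0) y 0)) ?_ ?_ ?_ ?_ ?_
  · rintro ⟨m, φ⟩ h
    simp only [mem_product, mem_univ, true_and, mem_labellings] at h ⊢
    have hj := join_mate D hx hy
    refine ⟨fun z hz => ?_, fun z => ?_⟩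
    · rw [hj] at hz
      split_ifs at hz with h1 h2
      · exact absurd (hz.trans h1).symm hxy
      · exact absurd (hz.trans h2) hxy
      · rw [update_of_ne h2, update_of_ne h1, h.1 z hz]
    · rw [hj]
      split_ifs with h1 h2
      · subst h1; simp [hxy]
      · subst h2; simp [hxy]
      · have h3 : D.mate z ≠ x := fun e => h1 (by rw [← D.involutive z, e, hx])
        have h4 : D.mate z ≠ y := fun e => h2 (by rw [← D.involutive z, e, hy])
        rw [update_of_ne h2, update_of_ne h1, update_of_ne h4, update_of_ne h3, h.2]
  · intro φ h
    simp only [mem_product, mem_univ, true_and, mem_labellings] at h ⊢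
    have hj := join_mate D hx hy
    refine ⟨fun z hz => ?_, fun z => ?_⟩
    · by_cases h2 : z = y
      · subst h2; simp
      · by_cases h1 : z = x
        · subst h1; simp [h2]
        · rw [update_of_ne h2, update_of_ne h1]
          exact h.1 z (by rw [hj, if_neg h1, if_neg h2, hz])
    · by_cases h2 : z = y
      · rw [h2, hy]
      · by_cases h1 : z = x
        · rw [h1, hx]
        · have h3 : D.mate z ≠ x := fun e => h1 (by rw [← D.involutive z, e, hx])
          have h4 : D.mate z ≠ y := fun e => h2 (by rw [← D.involutive z, e, hy])
          rw [update_of_ne h2, update_of_ne h1, update_of_ne h4, update_of_ne h3, ← h.2 z, hj,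
            if_neg h1, if_neg h2]
  · rintro ⟨m, φ⟩ h
    simp only [mem_product, mem_univ, true_and, mem_labellings] at h
    refine Prod.ext (by simp [hxy]) ?_
    ext1 z
    by_cases h2 : z = y
    · subst h2; simp [h.1 _ hy]
    · by_cases h1 : z = x
      · subst h1; simp [h2, h.1 _ hx]
      · simp [h1, h2]
  · intro φ h
    simp only [mem_labellings] at h
    have : φ y = φ x := by rw [← h.2 x, join_mate D hx hy, if_pos rfl]
    ext1 z
    by_cases h2 : z = y
    · subst h2; simp [this]
    · by_cases h1 : z = x
      · subst h1; simp [h2]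
      · simp [h1, h2]
  · rintro ⟨m, φ⟩ h
    simp only [L.chordProd_join hx hy hxy, L.letters_join hx hy hxy, mul_smul]

theorem contract_eq_erase (D : ChordDiagram N) {x : Fin N} (hx : D.mate x ≠ x)
    (G : (Fin N → A) → A) :
    L.contract D G = ∑ m, L.g m • L.contract (D.erase x)
      (fun ψ => G (update (update ψ x (L.X m)) (D.mate x) (L.X m))) := by
  conv_lhs => rw [← D.join_erase x]
  exact L.contract_join (D.erase_mate_self x) (by simp [erase_mate]) hx.symm G

theorem contract_derivAt_fixed {D : ChordDiagram N} {p : Fin N} (h : D.mate p = p) (x : A)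
    (G : MultilinearMap K (fun _ : Fin N => A) A) : L.contract D (derivAt x p G) = 0 := by
  rw [← L.contract_zero D]
  exact L.contract_congr fun φ => derivAt_of_eq_one _ _ _ _ (L.letters_of_fixed h φ)

theorem derivAt_update_X (G : MultilinearMap K (fun _ : Fin N => A) A) (ψ : Fin N → A) (p : Fin N)
    (k m : Fin 4) : derivAt (L.X k) p G (update ψ p (L.X m)) =
      ∑ n, L.f k m n • G (update ψ p (L.X n)) := by
  rw [derivAt_apply, update_idem, update_self, L.lie, G.map_update_sum]
  simp only [G.map_update_smul]

/-- Invariance of the tensor attached to a chord. -/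
theorem contract_derivAt_add_mate (D : ChordDiagram N) {p : Fin N} (hp : D.mate p ≠ p) (k : Fin 4)
    (G : MultilinearMap K (fun _ : Fin N => A) A) :
    L.contract D (derivAt (L.X k) p G) + L.contract D (derivAt (L.X k) (D.mate p) G) = 0 := by
  have h1 : L.contract D (derivAt (L.X k) p G) = ∑ m, ∑ n, (L.g m * L.f k m n) •
      L.contract (D.erase p) (fun ψ => G (update (update ψ p (L.X n)) (D.mate p) (L.X m))) := by
    rw [L.contract_eq_erase D hp]
    refine sum_congr rfl fun m _ => ?_
    simp only [mul_smul, ← smul_sum]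
    congr 1
    simp only [← contract_smul, ← contract_sum]
    refine L.contract_congr fun φ => ?_
    rw [update_comm hp.symm, derivAt_update_X]
    simp only [update_comm hp]
  have h2 : L.contract D (derivAt (L.X k) (D.mate p) G) = ∑ m, ∑ n, (L.g m * L.f k m n) •
      L.contract (D.erase p) (fun ψ => G (update (update ψ p (L.X m)) (D.mate p) (L.X n))) := by
    rw [L.contract_eq_erase D hp]
    refine sum_congr rfl fun m _ => ?_
    simp only [mul_smul, ← smul_sum]
    congr 1
    simp only [← contract_smul, ← contract_sum]
    refine L.contract_congr fun φ => ?_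
    rw [derivAt_update_X]
  -- Exchanging the summation indices in the first sum makes both sums run over the same insertions;
  -- the coefficients then cancel by invariance.
  rw [h1, h2, sum_comm, ← sum_add_distrib]
  refine sum_eq_zero fun m _ => ?_
  rw [← sum_add_distrib]
  refine sum_eq_zero fun n _ => ?_
  rw [← add_smul, L.invariant, zero_smul]

end LieFrame

end A1

/-! ### Double commutators along the line and the Casimir element -/

namespace A1

open Finset Function ChordDiagram

/-- The Leibniz rule for the inner derivation by `x`. -/
theorem commutator_list_prod {A ι : Type*} [Ring A] [DecidableEq ι] (x : A) (ψ : ι → A) (l : List ι)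
    (hl : l.Nodup) : x * (l.map ψ).prod - (l.map ψ).prod * x =
      ∑ p ∈ l.toFinset, (l.map (update ψ p (x * ψ p - ψ p * x))).prod := by
  rw [List.sum_toFinset _ hl]
  induction l with
  | nil => simp
  | cons i l ih =>
    obtain ⟨hi, hl⟩ := List.nodup_cons.1 hl
    have h1 : ∀ v, l.map (update ψ i v) = l.map ψ := fun v =>
      List.map_congr_left fun z hz => update_of_ne (ne_of_mem_of_not_mem hz hi) _ _
    have h2 : (l.map fun p => ((i :: l).map (update ψ p (x * ψ p - ψ p * x))).prod) =
        l.map fun p => ψ i * (l.map (update ψ p (x * ψ p - ψ p * x))).prod :=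
      List.map_congr_left fun p hp => by
        rw [List.map_cons, List.prod_cons, update_of_ne (ne_of_mem_of_not_mem hp hi).symm]
    rw [List.map_cons (f := fun p => ((i :: l).map (update ψ p (x * ψ p - ψ p * x))).prod),
      List.sum_cons, h2, List.sum_map_mul_left, ← ih hl]
    simp only [List.map_cons, List.prod_cons, update_self, h1]
    noncomm_ring

theorem exists_finRange_eq_append {N : ℕ} (a : Fin N) :
    ∃ l₁ l₂, List.finRange N = l₁ ++ a :: l₂ ∧ a ∉ l₁ ∧ a ∉ l₂ := by
  obtain ⟨l₁, l₂, h⟩ := List.append_of_mem (List.mem_finRange a)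
  have hn := List.nodup_finRange N
  rw [h, List.nodup_append] at hn
  obtain ⟨-, h2, h3⟩ := hn
  exact ⟨l₁, l₂, h, fun e => h3 a e a (by simp) rfl, (List.nodup_cons.1 h2).1⟩

theorem exists_finRange_eq_append_Ioo {N : ℕ} {a b : Fin N} (hab : a < b) :
    ∃ l₁ l₂ l₃, List.finRange N = l₁ ++ a :: (l₂ ++ b :: l₃) ∧ l₂.Nodup ∧
      l₂.toFinset = Ioo a b ∧ (∀ z ∈ l₁, z < a) ∧ ∀ z ∈ l₃, b < z := by
  obtain ⟨l₁, l, h, -, -⟩ := exists_finRange_eq_append a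
  have hs := List.pairwise_lt_finRange N
  have hm := fun z : Fin N => List.mem_finRange z
  simp only [h, List.pairwise_append, List.pairwise_cons, List.mem_cons, List.mem_append] at hs hm
  have hb : b ∈ l := by
    rcases hm b with h1 | h1 | h1
    · exact absurd (hs.2.2 b h1 a (Or.inl rfl)) (not_lt.2 hab.le)
    · exact absurd h1 hab.ne'
    · exact h1
  obtain ⟨l₂, l₃, rfl⟩ := List.append_of_mem hb
  simp only [List.pairwise_append, List.pairwise_cons, List.mem_cons, List.mem_append] at hs hm
  obtain ⟨-, ⟨h1, h2, ⟨h3, -⟩, h4⟩, h5⟩ := hs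
  refine ⟨l₁, l₂, l₃, h, h2.imp (fun h => h.ne), ?_, fun z hz => h5 z hz a (Or.inl rfl), h3⟩
  ext z
  rw [List.mem_toFinset, mem_Ioo]
  refine ⟨fun hz => ⟨h1 z (Or.inl hz), h4 z hz b (Or.inl rfl)⟩, fun hz => ?_⟩
  rcases hm z with h | h | h | h | h
  · exact absurd (h5 z h a (Or.inl rfl)) (not_lt.2 hz.1.le)
  · exact absurd h hz.1.ne'
  · exact h
  · exact absurd h hz.2.ne
  · exact absurd (h3 z h) (not_lt.2 hz.2.le)

theorem map_update_of_notMem {A ι : Type*} [DecidableEq ι] (ψ : ι → A) (v : A) {p : ι} {l : List ι}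
    (h : p ∉ l) : l.map (update ψ p v) = l.map ψ :=
  List.map_congr_left fun _ hz => update_of_ne (ne_of_mem_of_not_mem hz h) _ _

variable {K : Type*} [Field K] {ε : K} {A : Type*} [Ring A] [Algebra K A] {N : ℕ}

/-- A product with `x` inserted at two places, in terms of double commutators. -/
theorem exists_word_factorization {a b : Fin N} (hab : a < b) (ψ : Fin N → A) (ha : ψ a = 1)
    (hb : ψ b = 1) : ∃ u v w : A, word K N A ψ = u * v * w ∧
      (∀ z : A, (∀ p, Commute z (ψ p)) → Commute z u ∧ Commute z v) ∧
      ∀ x : A, 2 * word K N A (update (update ψ a x) b x) = u * (x * x) * v * w +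
        u * v * (x * x) * w - ∑ p ∈ Ioo a b, ∑ q ∈ Ioo a b,
          derivAt x p (derivAt x q (word K N A)) ψ := by
  obtain ⟨l₁, l₂, l₃, h, hn, hI, h1, h3⟩ := exists_finRange_eq_append_Ioo hab
  have hmem : ∀ z, z ∈ l₂ ↔ a < z ∧ z < b := fun z => by rw [← List.mem_toFinset, hI, mem_Ioo]
  have hw : ∀ χ : Fin N → A, word K N A χ =
      (l₁.map χ).prod * χ a * (l₂.map χ).prod * χ b * (l₃.map χ).prod := fun χ => by
    rw [word_apply, h]
    simp only [List.map_append, List.map_cons, List.prod_append, List.prod_cons, mul_assoc]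
  have n1 : ∀ p, a ≤ p → p ∉ l₁ := fun p hp hm => absurd (h1 p hm) (not_lt.2 hp)
  have n3 : ∀ p, p ≤ b → p ∉ l₃ := fun p hp hm => absurd (h3 p hm) (not_lt.2 hp)
  have na : a ∉ l₂ := fun hm => lt_irrefl _ ((hmem _).1 hm).1
  have nb : b ∉ l₂ := fun hm => lt_irrefl _ ((hmem _).1 hm).2
  refine ⟨(l₁.map ψ).prod, (l₂.map ψ).prod, (l₃.map ψ).prod, ?_, fun z hz => ⟨?_, ?_⟩, fun x => ?_⟩
  · rw [hw, ha, hb, mul_one, mul_one]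
  · exact Commute.list_prod_right _ _ (by simpa using fun p _ => hz p)
  · exact Commute.list_prod_right _ _ (by simpa using fun p _ => hz p)
  · have hin : ∀ χ : Fin N → A, ∀ p ∈ Ioo a b, ∀ v, word K N A (update χ p v) =
        (l₁.map χ).prod * χ a * (l₂.map (update χ p v)).prod * χ b * (l₃.map χ).prod := by
      intro χ p hp v
      rw [mem_Ioo] at hp
      rw [hw, map_update_of_notMem _ _ (n1 p hp.1.le), map_update_of_notMem _ _ (n3 p hp.2.le),
        update_of_ne hp.1.ne, update_of_ne hp.2.ne']
    -- The inner commutator has been expanded over `p`; the Leibniz rule expands the outer one over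
    -- `q`, with `q = p` allowed.
    have key : ∀ p ∈ Ioo a b, ∑ q ∈ Ioo a b, derivAt x p (derivAt x q (word K N A)) ψ =
        (l₁.map ψ).prod * (x * (l₂.map (update ψ p (x * ψ p - ψ p * x))).prod -
          (l₂.map (update ψ p (x * ψ p - ψ p * x))).prod * x) * (l₃.map ψ).prod := by
      intro p hp
      have hp' := mem_Ioo.1 hp
      rw [commutator_list_prod _ _ _ hn, hI, mul_sum, sum_mul]
      refine sum_congr rfl fun q hq => ?_
      rw [derivAt_apply, derivAt_apply, hin _ q hq, map_update_of_notMem _ _ (n1 p hp'.1.le),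
        map_update_of_notMem _ _ (n3 p hp'.2.le), update_of_ne hp'.1.ne, update_of_ne hp'.2.ne',
        ha, hb, mul_one, mul_one]
    rw [sum_congr rfl key, ← sum_mul, ← mul_sum, sum_sub_distrib, ← mul_sum, ← sum_mul, ← hI,
      ← commutator_list_prod _ _ _ hn, hw, update_self, update_of_ne hab.ne, update_self,
      map_update_of_notMem _ _ (n1 b hab.le), map_update_of_notMem _ _ (n1 a le_rfl),
      map_update_of_notMem _ _ nb, map_update_of_notMem _ _ na,
      map_update_of_notMem _ _ (n3 b le_rfl), map_update_of_notMem _ _ (n3 a hab.le)]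
    -- What remains is `2xvx = x²v + vx² - [x,[x,v]]`, multiplied by the outer factors.
    noncomm_ring

namespace LieFrame

variable (L : LieFrame ε A)

theorem commute_X_zero (k : Fin 4) : Commute (L.X 0) (L.X k) := by
  have := L.lie k 0
  simp only [L.f_zero, zero_smul, sum_const_zero] at this
  exact (sub_eq_zero.1 this).symm

/-- The Casimir element. -/
def cas : A := ∑ k, L.g k • (L.X k * L.X k)

/-- The commutator of `X l` with the Casimir element has coefficients `g k * f l k n`, which
invariance makes antisymmetric in `k` and `n`, against a symmetrized product. -/
theorem commute_cas (l : Fin 4) : Commute L.cas (L.X l) := by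
  have h : L.X l * L.cas - L.cas * L.X l = 0 := by
    have h1 : ∀ k, L.X l * (L.g k • (L.X k * L.X k)) - L.g k • (L.X k * L.X k) * L.X l =
        (∑ n, (L.g k * L.f l k n) • (L.X n * L.X k)) +
          ∑ n, (L.g k * L.f l k n) • (L.X k * L.X n) := by
      intro k
      have h2 : L.X l * (L.g k • (L.X k * L.X k)) - L.g k • (L.X k * L.X k) * L.X l =
          L.g k • ((L.X l * L.X k - L.X k * L.X l) * L.X k +
            L.X k * (L.X l * L.X k - L.X k * L.X l)) := by
        rw [mul_smul_comm, smul_mul_assoc, ← smul_sub]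
        congr 1
        noncomm_ring
      rw [h2, L.lie, smul_add, sum_mul, mul_sum, smul_sum, smul_sum]
      simp only [smul_mul_assoc, mul_smul_comm, smul_smul]
    rw [cas, mul_sum, sum_mul, ← sum_sub_distrib, sum_congr rfl fun k _ => h1 k, sum_add_distrib,
      sum_comm, ← sum_add_distrib]
    refine sum_eq_zero fun m _ => ?_
    rw [← sum_add_distrib]
    refine sum_eq_zero fun n _ => ?_
    rw [← add_smul, L.invariant, zero_smul]
  exact (sub_eq_zero.1 h).symm

/-- All the entries of `ψ` are equal to `1` or to a basis element. -/
def IsLetters (ψ : Fin N → A) : Prop := ∀ z, ψ z = 1 ∨ ∃ m, ψ z = L.X m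

variable {L}

theorem IsLetters.update {ψ : Fin N → A} (h : L.IsLetters ψ) (p : Fin N) (m : Fin 4) :
    L.IsLetters (update ψ p (L.X m)) := by
  intro z
  by_cases hz : z = p
  · subst hz; exact Or.inr ⟨m, by simp⟩
  · simpa [hz] using h z

theorem IsLetters.commute {ψ : Fin N → A} (h : L.IsLetters ψ) {z : A} (hz : ∀ m, Commute z (L.X m))
    (p : Fin N) : Commute z (ψ p) := by
  rcases h p with h | ⟨m, h⟩
  · rw [h]; exact Commute.one_right z
  · rw [h]; exact hz m

theorem IsLetters.word_update_X_zero {ψ : Fin N → A} (h : L.IsLetters ψ) {p : Fin N}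
    (hp : ψ p = 1) : word K N A (Function.update ψ p (L.X 0)) = L.X 0 * word K N A ψ := by
  obtain ⟨l₁, l₂, e, h1, h2⟩ := exists_finRange_eq_append p
  simp only [word_apply, e, List.map_append, List.map_cons, List.prod_append, List.prod_cons,
    map_update_of_notMem _ _ h1, map_update_of_notMem _ _ h2, update_self, hp, one_mul]
  have : Commute (L.X 0) (l₁.map ψ).prod :=
    Commute.list_prod_right _ _ (by simpa using fun p _ => h.commute L.commute_X_zero p)
  rw [← mul_assoc, ← mul_assoc, this.eq]

variable (L)

theorem isLetters_letters (D : ChordDiagram N) (φ : Fin N → Fin 4) : L.IsLetters (L.letters D φ) := by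
  intro z
  by_cases h : D.mate z = z
  · exact Or.inl (if_pos h)
  · exact Or.inr ⟨φ z, if_neg h⟩

/-- The sum over all labellings of the products along the line. -/
noncomputable def weight (D : ChordDiagram N) : A := L.contract D (word K N A)

/-- The polarized Casimir operator at the points `p` and `q`. -/
noncomputable def pair (D : ChordDiagram N) (p q : Fin N) : A :=
  ∑ k, L.g k • L.contract D (derivAt (L.X k) p (derivAt (L.X k) q (word K N A)))

theorem pair_comm (D : ChordDiagram N) (p q : Fin N) : L.pair D p q = L.pair D q p := by
  simp only [pair, derivAt_comm _ p q]

theorem pair_of_fixed {D : ChordDiagram N} {p : Fin N} (h : D.mate p = p) (q : Fin N) :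
    L.pair D p q = 0 := by
  simp only [pair, L.contract_derivAt_fixed h, smul_zero, sum_const_zero]

/-- The tensor carried by a chord is invariant, so acting on one end is minus acting on the other.
-/
theorem pair_add_mate (D : ChordDiagram N) (p q : Fin N) :
    L.pair D p q + L.pair D (D.mate p) q = 0 := by
  by_cases h : D.mate p = p
  · rw [h, L.pair_of_fixed h, add_zero]
  · simp only [pair, ← sum_add_distrib, ← smul_add, L.contract_derivAt_add_mate D h, smul_zero,
      sum_const_zero]

/-- Summed over the labels of `a`, each `x²` of the factorization becomes the Casimir element, which
commutes with all letters and moves to the front. -/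
theorem two_mul_weight (D : ChordDiagram N) {a : Fin N} (ha : a < D.mate a) :
    2 * L.weight D = 2 * (L.cas * L.weight (D.erase a)) -
      ∑ p ∈ Ioo a (D.mate a), ∑ q ∈ Ioo a (D.mate a), L.pair (D.erase a) p q := by
  have h1 : ∑ p ∈ Ioo a (D.mate a), ∑ q ∈ Ioo a (D.mate a), L.pair (D.erase a) p q =
      L.contract (D.erase a) (fun ψ => ∑ k, L.g k • ∑ p ∈ Ioo a (D.mate a),
        ∑ q ∈ Ioo a (D.mate a), derivAt (L.X k) p (derivAt (L.X k) q (word K N A)) ψ) := by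
    simp only [contract_sum, contract_smul, pair]
    simp only [smul_sum]
    exact (sum_congr rfl fun p _ => sum_comm).trans sum_comm
  rw [h1, weight, L.contract_eq_erase D ha.ne', weight]
  simp only [← contract_smul, ← contract_sum, ← contract_mul_left, ← contract_sub]
  refine L.contract_congr fun φ => ?_
  obtain ⟨u, v, w, hw, hc, hx⟩ := exists_word_factorization (K := K) ha (L.letters (D.erase a) φ)
    (L.letters_of_fixed (D.erase_mate_self a) φ) (L.letters_of_fixed (by simp [erase_mate]) φ)
  obtain ⟨cu, cv⟩ := hc L.cas (fun p => (L.isLetters_letters _ φ).commute L.commute_cas p)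
  have h2 : ∑ k, L.g k • (u * (L.X k * L.X k) * v * w) = u * L.cas * v * w := by
    simp only [cas, mul_sum, sum_mul, mul_smul_comm, smul_mul_assoc]
  have h3 : ∑ k, L.g k • (u * v * (L.X k * L.X k) * w) = u * v * L.cas * w := by
    simp only [cas, mul_sum, sum_mul, mul_smul_comm, smul_mul_assoc]
  simp only [mul_sum, mul_smul_comm, hx, smul_sub, smul_add, sum_sub_distrib, sum_add_distrib, h2,
    h3, hw]
  rw [mul_assoc u v, ← cv.eq, ← mul_assoc u, ← cu.eq, two_mul]
  simp only [mul_assoc]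

/-- A chord with both ends between those of `a` contributes two opposite terms, and a point without
chord contributes `0`. -/
theorem sum_pair_Ioo (D : ChordDiagram N) {a : Fin N} (ha : a < D.mate a) (q : Fin N) :
    ∑ p ∈ Ioo a (D.mate a), L.pair (D.erase a) p q =
      ∑ p ∈ D.crossing a, L.pair (D.erase a) p q := by
  have hi := D.involutive
  have hsub : D.crossing a ⊆ Ioo a (D.mate a) := fun p hp => ((mem_crossing_of_lt ha).1 hp).2.1
  have hE : ∀ p ∈ Ioo a (D.mate a), (D.erase a).mate p = D.mate p := by
    intro p hp
    rw [mem_Ioo] at hp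
    rw [erase_mate, if_neg]
    rintro (h | h) <;> subst h
    exacts [lt_irrefl _ hp.1, lt_irrefl _ hp.2]
  rw [← sum_sdiff hsub, add_eq_right]
  refine sum_involution (fun p _ => (D.erase a).mate p) (fun p _ => L.pair_add_mate _ p q)
    (fun p _ hne he => hne (L.pair_of_fixed he q)) (fun p hp => ?_)
    (fun p _ => (D.erase a).involutive p)
  rw [mem_sdiff] at hp ⊢
  rw [hE p hp.1]
  rw [mem_crossing_of_lt ha] at hp ⊢
  rw [hi]
  by_cases h : D.mate p = p
  · rw [h]; exact ⟨hp.1, fun h' => h'.1 rfl⟩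
  · have : D.mate p ∈ Ioo a (D.mate a) := by tauto
    tauto

theorem two_mul_weight_eq_crossing (D : ChordDiagram N) {a : Fin N} (ha : a < D.mate a) :
    2 * L.weight D = 2 * (L.cas * L.weight (D.erase a)) -
      ∑ p ∈ D.crossing a, ∑ q ∈ D.crossing a, L.pair (D.erase a) p q := by
  have h : ∑ p ∈ Ioo a (D.mate a), ∑ q ∈ Ioo a (D.mate a), L.pair (D.erase a) p q =
      ∑ p ∈ D.crossing a, ∑ q ∈ D.crossing a, L.pair (D.erase a) p q := by
    rw [sum_comm]
    calc ∑ q ∈ Ioo a (D.mate a), ∑ p ∈ Ioo a (D.mate a), L.pair (D.erase a) p q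
      = ∑ q ∈ Ioo a (D.mate a), ∑ p ∈ D.crossing a, L.pair (D.erase a) q p :=
        sum_congr rfl fun q _ => (L.sum_pair_Ioo D ha q).trans
          (sum_congr rfl fun p _ => L.pair_comm _ _ _)
    _ = ∑ p ∈ D.crossing a, ∑ q ∈ D.crossing a, L.pair (D.erase a) p q := by
        rw [sum_comm]
        exact sum_congr rfl fun p _ => (L.sum_pair_Ioo D ha p).trans
          (sum_congr rfl fun q _ => L.pair_comm _ _ _)
  rw [L.two_mul_weight D ha, h]

end LieFrame

end A1

/-! ### The polarized Casimir operator on one chord and on two chords -/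

namespace A1

open Finset Function ChordDiagram

variable {K : Type*} [Field K] {ε : K} {A : Type*} [Ring A] [Algebra K A] {N : ℕ}

namespace LieFrame

variable (L : LieFrame ε A)

/-- Basis elements inserted at two points. -/
noncomputable def two (E : ChordDiagram N) (x y : Fin N) (i m : Fin 4) : A :=
  L.contract E fun ψ => word K N A (update (update ψ x (L.X i)) y (L.X m))

theorem weight_join {E : ChordDiagram N} {x y : Fin N} (hx : E.mate x = x) (hy : E.mate y = y)
    (hxy : x ≠ y) : L.weight (E.join x y) = ∑ m, L.g m • L.two E x y m m :=
  L.contract_join hx hy hxy _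

theorem two_zero_zero {E : ChordDiagram N} {x y : Fin N} (hx : E.mate x = x) (hy : E.mate y = y)
    (hxy : x ≠ y) : L.two E x y 0 0 = L.X 0 * L.X 0 * L.weight E := by
  rw [two, weight, ← contract_mul_left]
  refine L.contract_congr fun φ => ?_
  have h := L.isLetters_letters E φ
  rw [(h.update x 0).word_update_X_zero, h.word_update_X_zero (L.letters_of_fixed hx φ), mul_assoc]
  rw [update_of_ne hxy.symm, L.letters_of_fixed hy]

/-- By `casimir` the label of the chord at `p` is multiplied by `2 * ε` if it is nonzero and by `0`
otherwise. The subtracted term is the missing label `0`, whose two central letters leave the word as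
`X 0 * X 0`. -/
theorem pair_self (E : ChordDiagram N) {p : Fin N} (hp : E.mate p ≠ p) :
    L.pair E p p = (2 * ε) • (L.weight E - L.X 0 * L.X 0 * L.weight (E.erase p)) := by
  have hf : (E.erase p).mate p = p := E.erase_mate_self p
  have hf' : (E.erase p).mate (E.mate p) = E.mate p := by simp [erase_mate]
  have h1 : L.weight E = ∑ m, L.g m • L.two (E.erase p) p (E.mate p) m m := by
    conv_lhs => rw [← E.join_erase p]
    exact L.weight_join hf hf' hp.symm
  have h2 : ∀ k, L.contract E (derivAt (L.X k) p (derivAt (L.X k) p (word K N A))) =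
      ∑ m, ∑ n, ∑ l, (L.g m * (L.f k m n * L.f k n l)) • L.two (E.erase p) p (E.mate p) l m := by
    intro k
    rw [L.contract_eq_erase E hp]
    refine sum_congr rfl fun m _ => ?_
    simp only [mul_smul, ← smul_sum, two]
    congr 1
    simp only [← contract_smul, ← contract_sum]
    refine L.contract_congr fun φ => ?_
    have hc : ∀ l, update (update (L.letters (E.erase p) φ) p (L.X l)) (E.mate p) (L.X m) =
        update (update (L.letters (E.erase p) φ) (E.mate p) (L.X m)) p (L.X l) :=
      fun l => update_comm hp.symm _ _ _
    simp only [hc, derivAt_update_X]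
  have h3 : L.pair E p p = ∑ m, ∑ l, (L.g m * ∑ k, ∑ n, L.g k * (L.f k m n * L.f k n l)) •
      L.two (E.erase p) p (E.mate p) l m := by
    simp only [pair, h2, mul_sum, sum_smul, smul_sum, smul_smul]
    rw [sum_comm]
    refine sum_congr rfl fun m _ => ?_
    refine (sum_congr rfl fun k _ => sum_comm).trans (sum_comm.trans ?_)
    refine sum_congr rfl fun l _ => sum_congr rfl fun k _ => sum_congr rfl fun n _ => ?_
    rw [mul_left_comm]
  rw [h3, h1, ← L.two_zero_zero hf hf' hp.symm]
  simp only [L.casimir]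
  simp only [Fin.sum_univ_four, L.g_zero]
  simp
  module

/-- Basis elements inserted at four points. -/
noncomputable def four (E : ChordDiagram N) (p p' q q' : Fin N) (i m j n : Fin 4) : A :=
  L.contract E fun ψ => word K N A
    (update (update (update (update ψ q (L.X j)) q' (L.X n)) p (L.X i)) p' (L.X m))

theorem pair_eq_sum_four (E : ChordDiagram N) {p q : Fin N} (hp : E.mate p ≠ p)
    (hq : E.mate q ≠ q) (hpq : E.Separate p q) :
    L.pair E p q = ∑ m, ∑ n, ∑ i, ∑ j, (∑ k, L.g k * L.g m * L.g n * (L.f k m i * L.f k n j)) •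
      L.four ((E.erase p).erase q) p (E.mate p) q (E.mate q) i m j n := by
  have hq' : (E.erase p).mate q = E.mate q := hpq.symm.erase_mate
  have d1 := hpq.ne
  have d2 := hpq.mate_right.ne
  have d3 := hpq.mate_left.ne
  have d4 := hpq.mate_left.mate_right.ne
  have h2 : ∀ k, L.contract E (derivAt (L.X k) p (derivAt (L.X k) q (word K N A))) =
      ∑ m, ∑ n, ∑ i, ∑ j, (L.g m * L.g n * (L.f k m i * L.f k n j)) •
        L.four ((E.erase p).erase q) p (E.mate p) q (E.mate q) i m j n := by
    intro k
    rw [L.contract_eq_erase E hp]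
    refine sum_congr rfl fun m _ => ?_
    rw [L.contract_eq_erase (E.erase p) (hq' ▸ hq), smul_sum]
    refine sum_congr rfl fun n _ => ?_
    simp only [mul_smul, ← smul_sum, four]
    congr 2
    simp only [← contract_smul, ← contract_sum]
    refine L.contract_congr fun φ => ?_
    rw [hq']
    have hd : ∀ (ψ : Fin N → A) (i : Fin 4), update (update ψ p (L.X i)) (E.mate p) (L.X m) =
        update (update ψ (E.mate p) (L.X m)) p (L.X i) := fun ψ i => update_comm hp.symm _ _ _
    simp only [hd, derivAt_update_X]
    refine sum_congr rfl fun i _ => ?_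
    congr 1
    -- The insertion at `q` must be outermost before the derivation at `q` can be expanded.
    have hc : ∀ j, update (update (update (update (L.letters ((E.erase p).erase q) φ) q (L.X j))
        (E.mate q) (L.X n)) (E.mate p) (L.X m)) p (L.X i) =
        update (update (update (update (L.letters ((E.erase p).erase q) φ)
        (E.mate q) (L.X n)) (E.mate p) (L.X m)) p (L.X i)) q (L.X j) := by
      intro j
      rw [update_comm hq.symm, update_comm d3.symm, update_comm d1.symm]
    simp only [hc, derivAt_update_X]
  simp only [pair, h2, smul_sum, sum_smul, smul_smul]
  rw [sum_comm]
  refine sum_congr rfl fun m _ => ?_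
  rw [sum_comm]
  refine sum_congr rfl fun n _ => ?_
  rw [sum_comm]
  refine sum_congr rfl fun i _ => ?_
  rw [sum_comm]
  refine sum_congr rfl fun j _ => sum_congr rfl fun k _ => ?_
  rw [mul_assoc, mul_assoc, mul_assoc]

/-- `exchange` sums over nonzero indices only; completing the sums to all indices costs the two
correction sums with a label `0`. -/
theorem sum_exchange {M : Type*} [AddCommGroup M] [Module K M] (T : Fin 4 → Fin 4 → Fin 4 → Fin 4 → M) :
    ∑ m, ∑ n, ∑ i, ∑ j, (∑ k, L.g k * L.g m * L.g n * (L.f k m i * L.f k n j)) • T i m j n =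
      -ε • (∑ i, ∑ m, (L.g i * L.g m) • (T i m i m - T i m m i) -
        ∑ m, L.g m • (T 0 m 0 m - T 0 m m 0) - ∑ m, L.g m • (T m 0 m 0 - T m 0 0 m)) := by
  have h1 : ∀ m n i j, (∑ k, L.g k * L.g m * L.g n * (L.f k m i * L.f k n j)) • T i m j n =
      -ε • ((if i = j then if m = n then if i ≠ 0 ∧ m ≠ 0 then (L.g i * L.g m) • T i m i m else 0
        else 0 else 0) -
        if j = m then if i = n then if i ≠ 0 ∧ m ≠ 0 then (L.g i * L.g m) • T i m m i else 0
        else 0 else 0) := by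
    intro m n i j
    rw [L.exchange, mul_smul, sub_smul]
    congr 2
    · split_ifs <;> simp_all
    · split_ifs <;> simp_all
  -- The overlap `i = m = 0` needs no separate term: there the two values of `T` coincide.
  have h2 : ∀ i m, (if i ≠ 0 ∧ m ≠ 0 then (L.g i * L.g m) • T i m i m else 0) -
      (if i ≠ 0 ∧ m ≠ 0 then (L.g i * L.g m) • T i m m i else 0) =
      (L.g i * L.g m) • (T i m i m - T i m m i) -
        (if i = 0 then L.g m • (T 0 m 0 m - T 0 m m 0) else 0) -
        if m = 0 then L.g i • (T i 0 i 0 - T i 0 0 i) else 0 := by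
    intro i m
    by_cases hi : i = 0 <;> by_cases hm : m = 0 <;> simp [hi, hm, L.g_zero, smul_sub]
  have h3 : ∀ m, ∑ n, ∑ i, ∑ j, (∑ k, L.g k * L.g m * L.g n * (L.f k m i * L.f k n j)) • T i m j n =
      -ε • ∑ i, ((L.g i * L.g m) • (T i m i m - T i m m i) -
        (if i = 0 then L.g m • (T 0 m 0 m - T 0 m m 0) else 0) -
        if m = 0 then L.g i • (T i 0 i 0 - T i 0 0 i) else 0) := by
    intro m
    rw [sum_comm, smul_sum]
    refine sum_congr rfl fun i _ => ?_
    simp only [h1, ← smul_sum, sum_sub_distrib]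
    rw [← h2]
    simp
  simp only [h3, ← smul_sum]
  congr 1
  rw [sum_comm]
  simp only [sum_sub_distrib]
  simp

theorem four_swap_left (E : ChordDiagram N) {x y : Fin N} (z t : Fin N) (h : x ≠ y)
    (i m j n : Fin 4) : L.four E x y z t i m j n = L.four E y x z t m i j n := by
  simp only [four, update_comm h]

theorem four_swap_right (E : ChordDiagram N) {z t : Fin N} (x y : Fin N) (h : z ≠ t)
    (i m j n : Fin 4) : L.four E x y z t i m j n = L.four E x y t z i m n j := by
  simp only [four]
  refine L.contract_congr fun φ => ?_
  rw [update_comm h]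

theorem four_swap_middle (E : ChordDiagram N) {x t : Fin N} (y z : Fin N) (h : x ≠ t)
    (i m j n : Fin 4) : L.four E x y z t i m j n = L.four E t y z x n m j i := by
  simp only [four]
  refine L.contract_congr fun φ => ?_
  rw [update_comm h]

theorem weight_join_join {E : ChordDiagram N} {x y z t : Fin N} (hx : E.mate x = x)
    (hy : E.mate y = y) (hz : E.mate z = z) (ht : E.mate t = t) (hxy : x ≠ y) (hzt : z ≠ t)
    (hxz : x ≠ z) (hxt : x ≠ t) (hyz : y ≠ z) (hyt : y ≠ t) :
    L.weight ((E.join x y).join z t) = ∑ i, ∑ m, (L.g i * L.g m) • L.four E z t x y m m i i := by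
  have hz' : (E.join x y).mate z = z := by
    rw [join_mate _ hx hy, if_neg hxz.symm, if_neg hyz.symm, hz]
  have ht' : (E.join x y).mate t = t := by
    rw [join_mate _ hx hy, if_neg hxt.symm, if_neg hyt.symm, ht]
  rw [weight, L.contract_join hz' ht' hzt, sum_comm]
  refine sum_congr rfl fun m _ => ?_
  rw [L.contract_join hx hy hxy, smul_sum]
  simp only [smul_smul, mul_comm (L.g m)]
  rfl

theorem four_zero_zero {E : ChordDiagram N} {x y z t : Fin N} (hz : E.mate z = z)
    (ht : E.mate t = t) (hzt : z ≠ t)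
    (hxz : x ≠ z) (hxt : x ≠ t) (hyz : y ≠ z) (hyt : y ≠ t) (i m : Fin 4) :
    L.four E z t x y 0 0 i m = L.X 0 * L.X 0 * L.two E x y i m := by
  rw [two, four, ← contract_mul_left]
  refine L.contract_congr fun φ => ?_
  have h := ((L.isLetters_letters E φ).update x i).update y m
  rw [(h.update z 0).word_update_X_zero, h.word_update_X_zero, mul_assoc]
  · rw [update_of_ne hyz.symm, update_of_ne hxz.symm, L.letters_of_fixed hz]
  · rw [update_of_ne hzt.symm, update_of_ne hyt.symm, update_of_ne hxt.symm, L.letters_of_fixed ht]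

/-- The polarized Casimir operator at ends of two different chords. -/
theorem pair_of_separate (E : ChordDiagram N) {p q : Fin N} (hp : E.mate p ≠ p)
    (hq : E.mate q ≠ q) (hpq : E.Separate p q) :
    let E' := (E.erase p).erase q
    L.pair E p q = -ε • (L.weight ((E'.join p q).join (E.mate p) (E.mate q)) -
      L.weight ((E'.join p (E.mate q)).join (E.mate p) q) +
      L.X 0 * L.X 0 * (L.weight (E'.join p (E.mate q)) + L.weight (E'.join (E.mate p) q) -
        L.weight (E'.join p q) - L.weight (E'.join (E.mate p) (E.mate q)))) := by
  intro E'
  have f2 : E'.mate q = q := (E.erase p).erase_mate_self q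
  have f1 : E'.mate p = p := erase_mate_of_fixed _ _ _ (E.erase_mate_self p)
  have f3 : E'.mate (E.mate p) = E.mate p := erase_mate_of_fixed _ _ _ (by simp [erase_mate])
  have f4 : E'.mate (E.mate q) = E.mate q := by
    rw [← hpq.symm.erase_mate]; simp [E', erase_mate (E.erase p) q]
  have d1 := hpq.ne
  have d2 := hpq.mate_right.ne
  have d3 := hpq.mate_left.ne
  have d4 := hpq.mate_left.mate_right.ne
  rw [L.pair_eq_sum_four E hp hq hpq, L.sum_exchange (fun i m j n =>
    L.four E' p (E.mate p) q (E.mate q) i m j n)]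
  rw [L.weight_join_join f1 f2 f3 f4 d1 d4 hp.symm d2 d3.symm hq.symm,
    L.weight_join_join f1 f4 f3 f2 d2 d3 hp.symm d1 d4.symm hq,
    L.weight_join f1 f4 d2, L.weight_join f3 f2 d3, L.weight_join f1 f2 d1, L.weight_join f3 f4 d4]
  -- `e1` to `e4` bring every pairing of the four ends to the single order `p, mate p, q, mate q`,
  -- so that only the pattern of labels distinguishes the diagrams.
  have e1 : ∀ i m j n, L.four E' (E.mate p) (E.mate q) p q m n i j =
      L.four E' p (E.mate p) q (E.mate q) i m j n := by
    intro i m j n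
    rw [four_swap_left _ _ _ _ d4, four_swap_right _ _ _ _ d1, four_swap_middle _ _ _ _ d2.symm]
  have e2 : ∀ i m j n, L.four E' (E.mate p) q p (E.mate q) m j i n =
      L.four E' p (E.mate p) q (E.mate q) i m j n := by
    intro i m j n
    rw [four_swap_left _ _ _ _ d3, four_swap_right _ _ _ _ d2, four_swap_middle _ _ _ _ d1.symm,
      four_swap_right _ _ _ _ hq]
  have e3 : ∀ i m j n, L.four E' p q (E.mate p) (E.mate q) i j m n =
      L.four E' p (E.mate p) q (E.mate q) i m j n := by
    intro i m j n
    rw [four_swap_left _ _ _ _ d1, four_swap_right _ _ _ _ d4, four_swap_middle _ _ _ _ d3.symm,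
      four_swap_left _ _ _ _ hp, four_swap_right _ _ _ _ hq]
  have e4 : ∀ i m j n, L.four E' p (E.mate q) (E.mate p) q i n m j =
      L.four E' p (E.mate p) q (E.mate q) i m j n := by
    intro i m j n
    rw [four_swap_left _ _ _ _ d2, four_swap_right _ _ _ _ d3, four_swap_middle _ _ _ _ d4.symm,
      four_swap_left _ _ _ _ hp]
  -- A new chord with label `0` amounts to two central letters, so it can be dropped in exchange for
  -- the factor `X 0 * X 0`.
  have z1 : ∀ i, L.X 0 * L.X 0 * L.two E' p q i i = L.four E' p (E.mate p) q (E.mate q) i 0 i 0 :=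
    fun i => by rw [← e1, L.four_zero_zero f3 f4 d4 hp.symm d2 d3.symm hq.symm]
  have z2 : ∀ i, L.X 0 * L.X 0 * L.two E' (E.mate p) (E.mate q) i i =
      L.four E' p (E.mate p) q (E.mate q) 0 i 0 i :=
    fun i => by rw [← e3, L.four_zero_zero f1 f2 d1 hp d3 d2.symm hq]
  have z3 : ∀ i, L.X 0 * L.X 0 * L.two E' p (E.mate q) i i =
      L.four E' p (E.mate p) q (E.mate q) i 0 0 i :=
    fun i => by rw [← e2, L.four_zero_zero f3 f2 d3 hp.symm d1 d4.symm hq]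
  have z4 : ∀ i, L.X 0 * L.X 0 * L.two E' (E.mate p) q i i =
      L.four E' p (E.mate p) q (E.mate q) 0 i i 0 :=
    fun i => by rw [← e4, L.four_zero_zero f1 f4 d2 hp d4 d1.symm hq.symm]
  simp only [mul_sub, mul_add, mul_sum, mul_smul_comm, z1, z2, z3, z4, e1, e2, smul_sub,
    sum_sub_distrib]
  module

end LieFrame

end A1

/-! ### The recursion and its symmetries -/

namespace A1

open Finset Function ChordDiagram

/-- The signed combination of the diagrams obtained by resolving the chord `a` and the ends of the
two chords with left ends `i` and `j` that intersect it. -/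
def resolve {R : Type*} [Ring R] {N : ℕ} (W : ChordDiagram N → R) (z : R) (D : ChordDiagram N)
    (a i j : Fin N) : R :=
  W (((erase₃ D a i j).join i j).join (D.mate i) (D.mate j)) -
    W (((erase₃ D a i j).join i (D.mate j)).join (D.mate i) j) +
    z * (W ((erase₃ D a i j).join i (D.mate j)) + W ((erase₃ D a i j).join (D.mate i) j) -
      W ((erase₃ D a i j).join i j) - W ((erase₃ D a i j).join (D.mate i) (D.mate j)))

/-- The recursion for the chord `a`, multiplied by two, as a sum over ordered pairs. -/
def Recursion {K R : Type*} [Field K] [Ring R] [Algebra K R] (ε : K) {N : ℕ}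
    (W : ChordDiagram N → R) (c z : R) (D : ChordDiagram N) (a : Fin N) : Prop :=
  (2 : K) • W D = (2 : K) • (c * W (D.erase a)) -
    (2 * ε) • ∑ i ∈ D.crossing a, (W (D.erase a) - z * W ((D.erase a).erase i)) +
    ε • ∑ i ∈ D.crossing a, ∑ j ∈ D.crossing a with j ≠ i, resolve W z D a i j

section

variable {R : Type*} [Ring R] {N : ℕ} {D : ChordDiagram N} {a i j : Fin N}

theorem erase₃_mate (hi : i ∈ D.crossing a) (hj : j ∈ D.crossing a) (hij : i ≠ j) (x : Fin N) :
    (erase₃ D a i j).mate x = if x = a ∨ x = D.mate a ∨ x = i ∨ x = D.mate i ∨ x = j ∨ x = D.mate j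
      then x else D.mate x := by
  have si := (ne_of_mem_crossing hi).2
  have sj := (ne_of_mem_crossing hj).2
  have sij := separate_of_mem_crossing hi hj hij
  have h1 : (D.erase a).mate i = D.mate i := si.erase_mate
  have h2 : (D.erase a).mate j = D.mate j := sj.erase_mate
  have h3 : ((D.erase a).erase i).mate j = D.mate j := by
    rw [← h2]
    refine Separate.erase_mate ⟨sij.ne.symm, ?_⟩
    rw [h1]
    exact sij.symm.ne_mate
  rw [erase₃, erase_mate, h3, erase_mate, h1, erase_mate]
  split_ifs <;> tauto

/-- The roles of the two chords are interchangeable; this turns the sum over ordered pairs into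
twice the sum over `i < j`. -/
theorem resolve_symm (W : ChordDiagram N → R) (z : R) (hi : i ∈ D.crossing a)
    (hj : j ∈ D.crossing a) (hij : i ≠ j) : resolve W z D a i j = resolve W z D a j i := by
  have s := separate_of_mem_crossing hi hj hij
  have e : erase₃ D a j i = erase₃ D a i j := erase_comm _ _ _
  have f := erase₃_mate hi hj hij
  have f1 : (erase₃ D a i j).mate i = i := by rw [f]; simp
  have f2 : (erase₃ D a i j).mate j = j := by rw [f]; simp
  have f3 : (erase₃ D a i j).mate (D.mate i) = D.mate i := by rw [f]; simp
  have f4 : (erase₃ D a i j).mate (D.mate j) = D.mate j := by rw [f]; simp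
  have d1 := (ne_of_mem_crossing hi).1
  have d2 := (ne_of_mem_crossing hj).1
  have d3 := s.mate_right.ne
  have d4 := s.mate_left.ne
  have d5 := s.mate_left.mate_right.ne
  have g1 : ((erase₃ D a i j).join j i).mate (D.mate i) = D.mate i := by
    rw [join_mate _ f2 f1, if_neg d4, if_neg d1, f3]
  have g2 : ((erase₃ D a i j).join j i).mate (D.mate j) = D.mate j := by
    rw [join_mate _ f2 f1, if_neg d2, if_neg d3.symm, f4]
  simp only [resolve, e]
  rw [join_comm _ f1 f2, join_comm _ g1 g2, join_comm _ f1 f4, join_comm _ f3 f2,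
    join_comm _ f3 f4, join_join_comm _ f2 f3 f4 f1 d2.symm hij.symm d5 d1]
  have g3 : ((erase₃ D a i j).join (D.mate j) i).mate j = j := by
    rw [join_mate _ f4 f1, if_neg d2.symm, if_neg hij.symm, f2]
  have g4 : ((erase₃ D a i j).join (D.mate j) i).mate (D.mate i) = D.mate i := by
    rw [join_mate _ f4 f1, if_neg d5, if_neg d1, f3]
  rw [join_comm _ g3 g4]
  abel_nf

/-- Reflecting the picture in the chord `a` preserves both pairings and swaps the single-chord
diagrams in pairs. -/
theorem resolve_mate (W : ChordDiagram N → R) (z : R) (hi : i ∈ D.crossing a)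
    (hj : j ∈ D.crossing a) (hij : i ≠ j) :
    resolve W z D (D.mate a) (D.mate i) (D.mate j) = resolve W z D a i j := by
  have s := separate_of_mem_crossing hi hj hij
  have si := (ne_of_mem_crossing hi).2
  have sj := (ne_of_mem_crossing hj).2
  have h1 : (D.erase a).mate i = D.mate i := si.erase_mate
  have h2 : (D.erase a).mate j = D.mate j := sj.erase_mate
  have h3 : ((D.erase a).erase i).mate j = D.mate j := by
    rw [← h2]
    refine Separate.erase_mate ⟨s.ne.symm, ?_⟩
    rw [h1]
    exact s.symm.ne_mate
  have e : erase₃ D (D.mate a) (D.mate i) (D.mate j) = erase₃ D a i j := by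
    rw [erase₃, erase₃, erase_of_mate, ← h1, erase_of_mate, ← h3, erase_of_mate]
  have f := erase₃_mate hi hj hij
  have f1 : (erase₃ D a i j).mate i = i := by rw [f]; simp
  have f2 : (erase₃ D a i j).mate j = j := by rw [f]; simp
  have f3 : (erase₃ D a i j).mate (D.mate i) = D.mate i := by rw [f]; simp
  have f4 : (erase₃ D a i j).mate (D.mate j) = D.mate j := by rw [f]; simp
  have d1 := (ne_of_mem_crossing hi).1
  have d2 := (ne_of_mem_crossing hj).1
  have d3 := s.mate_right.ne
  have d4 := s.mate_left.ne
  have d5 := s.mate_left.mate_right.ne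
  simp only [resolve, e, D.involutive]
  rw [join_join_comm _ f3 f4 f1 f2 d1 d4 d3.symm d2, join_join_comm _ f3 f2 f1 f4 d1 d5 hij.symm d2.symm]
  abel_nf

theorem resolve_conj (σ : Equiv.Perm (Fin N)) (W : ChordDiagram N → R) (z : R) :
    resolve W z (D.conj σ) (σ a) (σ i) (σ j) = resolve (fun D => W (D.conj σ)) z D a i j := by
  simp only [resolve, erase₃, conj_mate, conj_erase, conj_join]

theorem sum_ne_eq_two_nsmul {M : Type*} [AddCommMonoid M] {ι : Type*} [LinearOrder ι] (s : Finset ι)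
    (f : ι → ι → M) (h : ∀ i ∈ s, ∀ j ∈ s, i ≠ j → f i j = f j i) :
    ∑ i ∈ s, ∑ j ∈ s with j ≠ i, f i j = 2 • ∑ i ∈ s, ∑ j ∈ s with i < j, f i j := by
  have h1 : ∀ i ∈ s, ∑ j ∈ s with j ≠ i, f i j =
      ∑ j ∈ s, (if i < j then f i j else 0) + ∑ j ∈ s, if j < i then f j i else 0 := by
    intro i hi
    rw [sum_filter, ← sum_add_distrib]
    refine sum_congr rfl fun j hj => ?_
    rcases lt_trichotomy i j with hij | rfl | hij
    · simp [hij, hij.ne', hij.not_gt]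
    · simp
    · simp [hij, hij.ne, hij.not_gt, h i hi j hj hij.ne']
  rw [sum_congr rfl h1, sum_add_distrib, sum_comm (f := fun i j => if j < i then f j i else 0),
    two_nsmul]
  simp only [sum_filter]

end

variable {K : Type*} [Field K] {ε : K} {A : Type*} [Ring A] [Algebra K A] {N : ℕ}

theorem Recursion.of_mate {W : ChordDiagram N → A} {c z : A} {D : ChordDiagram N} {a : Fin N}
    (h : Recursion ε W c z D (D.mate a)) : Recursion ε W c z D a := by
  unfold Recursion at h ⊢
  have h1 : ∑ i ∈ D.crossing (D.mate a), (W (D.erase a) - z * W ((D.erase a).erase i)) =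
      ∑ i ∈ D.crossing a, (W (D.erase a) - z * W ((D.erase a).erase i)) := by
    rw [crossing_mate, sum_map]
    refine sum_congr rfl fun i hi => ?_
    have : (D.erase a).mate i = D.mate i := (ne_of_mem_crossing hi).2.erase_mate
    rw [Equiv.coe_toEmbedding, ← this, erase_of_mate]
  have h2 : ∑ i ∈ D.crossing (D.mate a), ∑ j ∈ D.crossing (D.mate a) with j ≠ i,
      resolve W z D (D.mate a) i j = ∑ i ∈ D.crossing a, ∑ j ∈ D.crossing a with j ≠ i,
      resolve W z D a i j := by
    rw [crossing_mate, sum_map]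
    refine sum_congr rfl fun i hi => ?_
    rw [sum_filter, sum_map, sum_filter]
    refine sum_congr rfl fun j hj => ?_
    simp only [Equiv.coe_toEmbedding, ne_eq, D.mate.injective.eq_iff]
    split_ifs with hij
    · rfl
    · rw [resolve_mate W z hi hj (Ne.symm hij)]
  rw [h, erase_of_mate, h1, h2]

/-- All diagrams are rotated alike, so independence of the weight from the cut is not needed. -/
theorem Recursion.of_rotate {W : ChordDiagram N → A} {c z : A} {D : ChordDiagram N} {a : Fin N}
    {p : ℕ} (h : Recursion ε W c z (D.rotate p) ((finRotate N ^ p) a)) :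
    Recursion ε (fun D => W (D.rotate p)) c z D a := by
  unfold Recursion at h ⊢
  rw [crossing_rotate, sum_map, sum_map] at h
  simp only [rotate_eq_conj, ← conj_erase, Equiv.coe_toEmbedding] at h
  have h2 : ∀ i, ∑ j ∈ (D.crossing a).map (finRotate N ^ p).toEmbedding with
      j ≠ (finRotate N ^ p) i, resolve W z (D.conj (finRotate N ^ p)) ((finRotate N ^ p) a)
        ((finRotate N ^ p) i) j =
      ∑ j ∈ D.crossing a with j ≠ i, resolve (fun D => W (D.rotate p)) z D a i j := by
    intro i
    rw [sum_filter, sum_map, sum_filter]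
    simp only [Equiv.coe_toEmbedding, ne_eq, (finRotate N ^ p).injective.eq_iff, resolve_conj,
      rotate_eq_conj]
  simp only [h2] at h
  exact h

/-- In the double sum over the crossing chords the diagonal is evaluated by `pair_self`, the rest by
`pair_of_separate`. -/
theorem LieFrame.recursion_of_lt (L : LieFrame ε A) (D : ChordDiagram N) {a : Fin N}
    (ha : a < D.mate a) : Recursion ε L.weight L.cas (L.X 0 * L.X 0) D a := by
  unfold Recursion
  have h1 : ∀ p ∈ D.crossing a, ∑ q ∈ D.crossing a, L.pair (D.erase a) p q =
      (2 * ε) • (L.weight (D.erase a) - L.X 0 * L.X 0 * L.weight ((D.erase a).erase p)) -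
      ε • ∑ q ∈ D.crossing a with q ≠ p, resolve L.weight (L.X 0 * L.X 0) D a p q := by
    intro p hp
    have ep : (D.erase a).mate p = D.mate p := (ne_of_mem_crossing hp).2.erase_mate
    have np : (D.erase a).mate p ≠ p := ep ▸ (ne_of_mem_crossing hp).1
    have h2 : ∑ q ∈ D.crossing a with q ≠ p, L.pair (D.erase a) p q =
        ∑ q ∈ D.crossing a with q ≠ p, -ε • resolve L.weight (L.X 0 * L.X 0) D a p q := by
      refine sum_congr rfl fun q hq => ?_
      obtain ⟨hq, hne⟩ := mem_filter.1 hq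
      have eq : (D.erase a).mate q = D.mate q := (ne_of_mem_crossing hq).2.erase_mate
      have nq : (D.erase a).mate q ≠ q := eq ▸ (ne_of_mem_crossing hq).1
      have s := separate_of_mem_crossing hp hq hne.symm
      rw [L.pair_of_separate (D.erase a) np nq ⟨s.ne, eq.symm ▸ s.ne_mate⟩, ep, eq]
      rfl
    rw [filter_ne' , ← smul_sum] at h2
    rw [← add_sum_erase _ _ hp, L.pair_self _ np, h2, filter_ne', neg_smul, ← sub_eq_add_neg]
  have h3 := L.two_mul_weight_eq_crossing D ha
  rw [sum_congr rfl h1, sum_sub_distrib, ← smul_sum, ← smul_sum] at h3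
  rw [two_smul, two_smul, ← two_mul, ← two_mul, h3]
  abel

theorem LieFrame.recursion (L : LieFrame ε A) (D : ChordDiagram N) {a : Fin N}
    (ha : D.mate a ≠ a) : Recursion ε L.weight L.cas (L.X 0 * L.X 0) D a := by
  rcases lt_or_gt_of_ne ha with h | h
  · exact Recursion.of_mate (L.recursion_of_lt D (by rwa [D.involutive]))
  · exact L.recursion_of_lt D h

end A1

/-! ### The cocycle and the sign of a word -/

namespace A1

open Finset Function ChordDiagram

variable {K : Type*} [Field K]

/-- The character of `ℤ₂` that takes the value `-1`. -/
def sgn (K : Type*) [Field K] (a : ZMod 2) : K := (-1) ^ a.val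

theorem sgn_add (a b : ZMod 2) : sgn K (a + b) = sgn K a * sgn K b := by
  have h : ∀ a : ZMod 2, a = 0 ∨ a = 1 := by decide
  have h11 : (1 + 1 : ZMod 2) = 0 := rfl
  rcases h a with rfl | rfl <;> rcases h b with rfl | rfl <;> simp [sgn, h11, ZMod.val_one]

theorem sgn_zero : sgn K 0 = 1 := by simp [sgn]

theorem sgn_mul_self (a : ZMod 2) : sgn K a * sgn K a = 1 := by
  rw [← sgn_add, CharTwo.add_self_eq_zero, sgn_zero]

/-- A bicharacter whose antisymmetrization is the commuting factor. -/
def cocycle (K : Type*) [Field K] (α β : ZMod 2 × ZMod 2) : K := sgn K (α.1 * β.2)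

theorem cocycle_add_right (α β γ : ZMod 2 × ZMod 2) :
    cocycle K α (β + γ) = cocycle K α β * cocycle K α γ := by
  simp only [cocycle, Prod.snd_add, mul_add, sgn_add]

theorem cocycle_zero_left (α : ZMod 2 × ZMod 2) : cocycle K 0 α = 1 := by
  simp [cocycle, sgn_zero]

theorem cocycle_zero_right (α : ZMod 2 × ZMod 2) : cocycle K α 0 = 1 := by
  simp [cocycle, sgn_zero]

theorem cocycle_sum_right {ι : Type*} (s : Finset ι) (α : ZMod 2 × ZMod 2)
    (γ : ι → ZMod 2 × ZMod 2) : cocycle K α (∑ i ∈ s, γ i) = ∏ i ∈ s, cocycle K α (γ i) := by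
  classical
  induction s using Finset.induction_on with
  | empty => simp [cocycle_zero_right]
  | insert i s hi ih => rw [sum_insert hi, prod_insert hi, cocycle_add_right, ih]

theorem cocycle_mul_self (α β : ZMod 2 × ZMod 2) : cocycle K α β * cocycle K α β = 1 :=
  sgn_mul_self _

theorem commFactor_eq (α β : ZMod 2 × ZMod 2) :
    commFactor K α β = cocycle K α β * cocycle K β α := by
  rw [cocycle, cocycle, ← sgn_add, mul_comm β.1, ← CharTwo.sub_eq_add]
  rfl

/-- The matrices with `E_α E_β = cocycle α β • E_{α + β}`. -/
def twist (K : Type*) [Field K] (α : ZMod 2 × ZMod 2) : Matrix (Fin 2) (Fin 2) K :=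
  !![1, 0; 0, -1] ^ α.2.val * !![0, 1; 1, 0] ^ α.1.val

theorem twist_zero : twist K 0 = 1 := by simp [twist]

theorem twist_mul (α β : ZMod 2 × ZMod 2) :
    twist K α * twist K β = cocycle K α β • twist K (α + β) := by
  obtain ⟨a, b⟩ := α
  obtain ⟨c, d⟩ := β
  have h : ∀ a : ZMod 2, a = 0 ∨ a = 1 := by decide
  have h11 : (1 + 1 : ZMod 2) = 0 := rfl
  rcases h a with rfl | rfl <;> rcases h b with rfl | rfl <;> rcases h c with rfl | rfl <;>
    rcases h d with rfl | rfl <;>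
    simp [twist, cocycle, sgn, h11, ZMod.val_one, Matrix.one_fin_two]

theorem list_prod_twist {N : ℕ} (γ : Fin N → ZMod 2 × ZMod 2) :
    ((List.finRange N).map fun x => twist K (γ x)).prod =
      (∏ x, ∏ y, if x < y then cocycle K (γ x) (γ y) else 1) • twist K (∑ x, γ x) := by
  induction N with
  | zero => simp [twist_zero]
  | succ N ih =>
    rw [List.finRange_succ, List.map_cons, List.prod_cons, List.map_map]
    have := ih (fun x => γ x.succ)
    simp only [comp_def]
    rw [this, Fin.sum_univ_succ, mul_smul_comm, twist_mul, smul_smul, cocycle_sum_right]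
    congr 1
    rw [Fin.prod_univ_succ (n := N), Fin.prod_univ_succ (n := N), mul_comm]
    simp only [lt_self_iff_false, if_false, Fin.succ_pos, if_true, one_mul]
    congr 1
    refine prod_congr rfl fun x _ => ?_
    rw [Fin.prod_univ_succ]
    simp

theorem prod_eq_prod_chords {N : ℕ} (D : ChordDiagram N) (G : Fin N → K)
    (hG : ∀ x, D.mate x = x → G x = 1) :
    ∏ x, G x = ∏ x with x < D.mate x, G x * G (D.mate x) := by
  rw [prod_mul_distrib, ← prod_filter_mul_prod_filter_not univ (fun x => x < D.mate x)]
  congr 1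
  have h1 : ∏ x with x < D.mate x, G (D.mate x) = ∏ x with D.mate x < x, G x := by
    refine prod_nbij' D.mate D.mate ?_ ?_ ?_ ?_ ?_ <;> simp [D.involutive]
  rw [h1]
  symm
  refine prod_subset (fun x hx => ?_) fun x _ hx => hG x ?_
  · simp only [mem_filter, mem_univ, true_and, not_lt] at hx ⊢
    exact hx.le
  · simp_all [le_antisymm_iff]

/-- Two chords without a crossing contribute each cocycle an even number of times, hence `1`.
Crossing chords contribute three factors in one order and one in the other, which is the commuting
factor. A chord with itself contributes one factor. -/
theorem prod_cocycle {N : ℕ} (D : ChordDiagram N) (γ : Fin N → ZMod 2 × ZMod 2)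
    (h0 : ∀ x, D.mate x = x → γ x = 0) (hγ : ∀ x, γ (D.mate x) = γ x) :
    (∏ x, ∏ y, if x < y then cocycle K (γ x) (γ y) else 1) =
      (∏ x with x < D.mate x, cocycle K (γ x) (γ x)) *
      ∏ e : Fin N × Fin N with e.1 < e.2 ∧ e.2 < D.mate e.1 ∧ D.mate e.1 < D.mate e.2,
        commFactor K (γ (D.mate e.1)) (γ e.2) := by
  have hi := D.involutive
  have h1 : ∀ x : Fin N, (∏ y, if x < y then cocycle K (γ x) (γ y) else 1) =
      ∏ y with y < D.mate y, (if x < y then cocycle K (γ x) (γ y) else 1) *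
        if x < D.mate y then cocycle K (γ x) (γ y) else 1 := by
    intro x
    rw [prod_eq_prod_chords D _ fun y hy => by rw [h0 y hy, cocycle_zero_right, ite_self]]
    simp only [hγ]
  have h2 : ∀ x, x < D.mate x → ∀ y, y < D.mate y →
      ((if x < y then cocycle K (γ x) (γ y) else 1) *
        if x < D.mate y then cocycle K (γ x) (γ y) else 1) *
      ((if D.mate x < y then cocycle K (γ x) (γ y) else 1) *
        if D.mate x < D.mate y then cocycle K (γ x) (γ y) else 1) =
      (if x = y then cocycle K (γ x) (γ x) else 1) *
      ((if x < y ∧ y < D.mate x ∧ D.mate x < D.mate y then cocycle K (γ x) (γ y) else 1) *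
        if y < x ∧ x < D.mate y ∧ D.mate y < D.mate x then cocycle K (γ x) (γ y) else 1) := by
    intro x hx y hy
    by_cases hxy : x = y
    · subst hxy
      simp [hx, hx.le]
    have hb := cocycle_mul_self (K := K) (γ x) (γ y)
    generalize cocycle K (γ x) (γ y) = b at hb ⊢
    have n1 : x ≠ D.mate y := fun e => by rw [e, hi] at hx; exact absurd hx (not_lt.2 hy.le)
    have n2 : D.mate x ≠ y := fun e => by rw [← e, hi] at hy; exact absurd hx (not_lt.2 hy.le)
    have n3 : D.mate x ≠ D.mate y := fun e => hxy (D.mate.injective e)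
    rw [if_neg hxy]
    -- With `b² = 1`, the cases are `b⁴ = 1` (disjoint), `b² = 1` (nested), `b³ = b` (crossing) and
    -- identities without reduction.
    split_ifs <;> first
      | (exfalso; omega)
      | linear_combination (b * b + 1) * hb
      | linear_combination hb
      | linear_combination b * hb
      | ring
  have h3 : (∏ x, ∏ y, if x < y then cocycle K (γ x) (γ y) else 1) =
      ∏ x with x < D.mate x, ∏ y with y < D.mate y,
      ((if x = y then cocycle K (γ x) (γ x) else 1) *
      ((if x < y ∧ y < D.mate x ∧ D.mate x < D.mate y then cocycle K (γ x) (γ y) else 1) *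
        if y < x ∧ x < D.mate y ∧ D.mate y < D.mate x then cocycle K (γ x) (γ y) else 1)) := by
    rw [prod_eq_prod_chords D]
    · refine prod_congr rfl fun x hx => ?_
      rw [h1, h1, ← prod_mul_distrib]
      refine prod_congr rfl fun y hy => ?_
      rw [hγ x]
      exact h2 x (mem_filter.1 hx).2 y (mem_filter.1 hy).2
    · intro x hx
      simp [h0 x hx, cocycle_zero_left]
  rw [h3]
  simp only [prod_mul_distrib]
  congr 1
  · refine prod_congr rfl fun x hx => ?_
    rw [prod_ite_eq, if_pos hx]
  · rw [prod_comm (f := fun x y => if y < x ∧ x < D.mate y ∧ D.mate y < D.mate x then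
      cocycle K (γ x) (γ y) else 1)]
    simp only [← prod_mul_distrib]
    rw [← univ_product_univ, prod_filter (s := univ ×ˢ univ), prod_product, prod_filter]
    refine prod_congr rfl fun x _ => ?_
    rw [prod_filter]
    split_ifs with hx
    · refine prod_congr rfl fun y _ => ?_
      simp only [hγ, commFactor_eq]
      split_ifs <;> first | rfl | simp | (exfalso; omega)
    · symm
      refine prod_eq_one fun y _ => if_neg ?_
      simp only
      omega

end A1

/-! ### Structure constants of the twisted Lie algebra -/

namespace A1

open Finset Function ChordDiagram TensorProduct

variable {K : Type*} [Field K] {ε : K}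

/-- The structure constants after the twist by the cocycle. -/
def structConst (ε : K) (k m n : Fin 4) : K := cocycle K (deg k) (deg m) * bracket ε k m n

/-- The same for `ε = e` an integer, as a table. -/
def structTable (e : ℤ) : Fin 4 → Fin 4 → Fin 4 → ℤ :=
  ![![![0, 0, 0, 0], ![0, 0, 0, 0], ![0, 0, 0, 0], ![0, 0, 0, 0]],
    ![![0, 0, 0, 0], ![0, 0, 0, 0], ![0, 0, 0, -1], ![0, 0, -1, 0]],
    ![![0, 0, 0, 0], ![0, 0, 0, 1], ![0, 0, 0, 0], ![0, e, 0, 0]],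
    ![![0, 0, 0, 0], ![0, 0, 1, 0], ![0, -e, 0, 0], ![0, 0, 0, 0]]]

/-- For `ε = ±1` the constants are integers, so the axioms of `LieFrame` become finite checks over
`ℤ`, transported to `K` by the cast. -/
theorem structConst_intCast (e : ℤ) (k m n : Fin 4) :
    structConst (e : K) k m n = (structTable e k m n : K) := by
  fin_cases k <;> fin_cases m <;> fin_cases n <;>
    simp [structConst, structTable, cocycle, sgn, deg, bracket, ZMod.val_one]

theorem structTable_zero : ∀ e ∈ [(1 : ℤ), -1], ∀ k n, structTable e k 0 n = 0 := by decide

theorem structTable_invariant : ∀ e ∈ [(1 : ℤ), -1], ∀ k m n,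
    ![1, e, 1, -1] m * structTable e k m n + ![1, e, 1, -1] n * structTable e k n m = 0 := by
  decide

theorem structTable_casimir : ∀ e ∈ [(1 : ℤ), -1], ∀ m l,
    ∑ k, ∑ n, ![1, e, 1, -1] k * (structTable e k m n * structTable e k n l) =
      if m = l ∧ m ≠ 0 then 2 * e else 0 := by
  decide

theorem structTable_exchange : ∀ e ∈ [(1 : ℤ), -1], ∀ m n i j,
    ∑ k, ![1, e, 1, -1] k * ![1, e, 1, -1] m * ![1, e, 1, -1] n *
      (structTable e k m i * structTable e k n j) =
    -e * ((if i = j ∧ i ≠ 0 ∧ m = n ∧ m ≠ 0 then ![1, e, 1, -1] i * ![1, e, 1, -1] m else 0) -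
      if i = n ∧ i ≠ 0 ∧ j = m ∧ j ≠ 0 then ![1, e, 1, -1] i * ![1, e, 1, -1] j else 0) := by
  decide

end A1

/-! ### Passage between the enveloping algebra and its twist -/

namespace A1

open Finset Function ChordDiagram TensorProduct

variable {K : Type*} [Field K] {ε : K}

/-- The inverse form after the twist by the cocycle. -/
def twistedForm (ε : K) : Fin 4 → K := ![1, ε, 1, -1]

theorem twistedForm_intCast (e : ℤ) (k : Fin 4) :
    twistedForm (e : K) k = ((![1, e, 1, -1] k : ℤ) : K) := by
  fin_cases k <;> simp [twistedForm]

theorem C_eq_diagonal (hε : ε = 1 ∨ ε = -1) : C ε = Matrix.diagonal ![1, ε, 1, 1] := by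
  apply Matrix.inv_eq_right_inv
  rw [B, Matrix.diagonal_mul_diagonal, ← Matrix.diagonal_one]
  congr 1
  ext i
  fin_cases i <;> rcases hε with rfl | rfl <;> simp

/-- Only degree `(1,1)` has `cocycle α α = -1`, which accounts for the last entry of `twistedForm`.
-/
theorem C_apply_self (hε : ε = 1 ∨ ε = -1) (i : Fin 4) :
    C ε i i = twistedForm ε i * cocycle K (deg i) (deg i) := by
  rw [C_eq_diagonal hε, Matrix.diagonal_apply_eq]
  fin_cases i <;> simp [twistedForm, cocycle, sgn, deg, ZMod.val_one]

theorem C_apply_ne (hε : ε = 1 ∨ ε = -1) {i j : Fin 4} (h : i ≠ j) : C ε i j = 0 := by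
  rw [C_eq_diagonal hε, Matrix.diagonal_apply_ne _ h]

theorem Q_mul_Q (i j : Fin 4) : Q ε i * Q ε j =
    commFactor K (deg i) (deg j) • (Q ε j * Q ε i) + ∑ k, bracket ε i j k • Q ε k := by
  have h := RingQuot.mkAlgHom_rel K (Rel.mk (ε := ε) i j)
  have h1 : ∀ k l, S K i j k l • (Q ε k * Q ε l) =
      if l = i then if k = j then commFactor K (deg i) (deg j) • (Q ε j * Q ε i) else 0 else 0 := by
    intro k l
    rw [S]
    split_ifs <;> simp_all
  simp only [map_mul, map_add, map_sum, map_smul] at h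
  change Q ε i * Q ε j = ∑ k, ∑ l, S K i j k l • (Q ε k * Q ε l) + ∑ k, bracket ε i j k • Q ε k at h
  rw [h]
  simp only [h1]
  simp

theorem bracket_eq_zero_or (ε : K) (i j k : Fin 4) :
    bracket ε i j k = 0 ∨ deg i + deg j = deg k := by
  fin_cases i <;> fin_cases j <;> fin_cases k <;>
    first | exact Or.inr (by decide) | exact Or.inl (by simp [bracket])

/-- The basis elements of the Lie algebra obtained by the twist. -/
noncomputable def twistedBasis (ε : K) (i : Fin 4) : U ε ⊗[K] Matrix (Fin 2) (Fin 2) K :=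
  Q ε i ⊗ₜ twist K (deg i)

/-- The cocycles of the two orders differ by the commuting factor, so the colour bracket becomes a
commutator; the bracket respects degrees, so the matrix factor is the right one. -/
theorem twistedBasis_lie (k m : Fin 4) :
    twistedBasis ε k * twistedBasis ε m - twistedBasis ε m * twistedBasis ε k =
      ∑ n, structConst ε k m n • twistedBasis ε n := by
  have h1 : ∀ n, structConst ε k m n • twistedBasis ε n =
      cocycle K (deg k) (deg m) • ((bracket ε k m n • Q ε n) ⊗ₜ[K] twist K (deg k + deg m)) := by
    intro n
    rcases bracket_eq_zero_or ε k m n with h | h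
    · simp [structConst, h]
    · rw [h, structConst, mul_smul, twistedBasis, TensorProduct.smul_tmul']
  have h2 : cocycle K (deg k) (deg m) * commFactor K (deg k) (deg m) = cocycle K (deg m) (deg k) := by
    rw [commFactor_eq, ← mul_assoc, cocycle_mul_self, one_mul]
  rw [twistedBasis, twistedBasis, Algebra.TensorProduct.tmul_mul_tmul,
    Algebra.TensorProduct.tmul_mul_tmul, twist_mul, twist_mul, add_comm (deg m), sum_congr rfl fun n _ => h1 n,
    ← smul_sum, ← TensorProduct.sum_tmul, Q_mul_Q k m, ← h2, TensorProduct.add_tmul]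
  simp only [TensorProduct.tmul_smul, TensorProduct.smul_tmul', mul_smul]
  abel

/-- The twist of the enveloping algebra as an algebra generated by a metric Lie algebra. -/
noncomputable def twistedFrame (hε : ε = 1 ∨ ε = -1) :
    LieFrame ε (U ε ⊗[K] Matrix (Fin 2) (Fin 2) K) :=
  have he : ∃ e ∈ [(1 : ℤ), -1], ε = (e : K) := by
    rcases hε with h | h
    · exact ⟨1, by simp, by simp [h]⟩
    · exact ⟨-1, by simp, by simp [h]⟩
  { X := twistedBasis ε
    f := structConst ε
    g := twistedForm ε
    lie := twistedBasis_lie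
    g_zero := rfl
    f_zero := by
      obtain ⟨e, he, rfl⟩ := he
      intro k n
      rw [structConst_intCast]
      exact_mod_cast congrArg (Int.cast (R := K)) (structTable_zero e he k n)
    invariant := by
      obtain ⟨e, he, rfl⟩ := he
      intro k m n
      simp only [structConst_intCast, twistedForm_intCast]
      exact_mod_cast congrArg (Int.cast (R := K)) (structTable_invariant e he k m n)
    casimir := by
      obtain ⟨e, he, rfl⟩ := he
      intro m l
      simp only [structConst_intCast, twistedForm_intCast]
      exact_mod_cast congrArg (Int.cast (R := K)) (structTable_casimir e he m l)
    exchange := by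
      obtain ⟨e, he, rfl⟩ := he
      intro m n i j
      simp only [structConst_intCast, twistedForm_intCast]
      exact_mod_cast congrArg (Int.cast (R := K)) (structTable_exchange e he m n i j )}

/-- The embedding of the enveloping algebra into its twist. -/
noncomputable abbrev untwist (ε : K) : U ε →ₐ[K] U ε ⊗[K] Matrix (Fin 2) (Fin 2) K :=
  Algebra.TensorProduct.includeLeft

theorem untwist_injective (ε : K) : Injective (untwist ε) :=
  Algebra.TensorProduct.includeLeft_injective (algebraMap K (Matrix (Fin 2) (Fin 2) K)).injective

theorem untwist_H_sq (hε : ε = 1 ∨ ε = -1) :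
    untwist ε (Q ε 0 * Q ε 0) = (twistedFrame hε).X 0 * (twistedFrame hε).X 0 := by
  have : twist K (deg 0) = 1 := twist_zero
  change _ = twistedBasis ε 0 * twistedBasis ε 0
  rw [twistedBasis, this, Algebra.TensorProduct.tmul_mul_tmul, one_mul]
  rfl

theorem untwist_c (hε : ε = 1 ∨ ε = -1) : untwist ε (c ε) = (twistedFrame hε).cas := by
  have hd : ∀ i, deg i + deg i = 0 := by decide
  rw [c, map_sum]
  refine sum_congr rfl fun i _ => ?_
  rw [sum_eq_single i (fun j _ hj => by rw [C_apply_ne hε hj.symm, zero_smul]) (by simp), map_smul,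
    C_apply_self hε, mul_smul]
  change _ = twistedForm ε i • (twistedBasis ε i * twistedBasis ε i)
  rw [twistedBasis, Algebra.TensorProduct.tmul_mul_tmul, twist_mul, hd, twist_zero,
    TensorProduct.tmul_smul]
  rfl

theorem list_prod_tmul {R M ι : Type*} [Ring R] [Algebra K R] [Ring M] [Algebra K M] (l : List ι)
    (u : ι → R) (v : ι → M) :
    (l.map fun x => u x ⊗ₜ[K] v x).prod = (l.map u).prod ⊗ₜ[K] (l.map v).prod := by
  induction l with
  | nil => rfl
  | cons i l ih => simp [ih, Algebra.TensorProduct.tmul_mul_tmul]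

/-- The matrix factor of each word is a scalar, which supplies precisely the signs that distinguish
the colour weight from the ordinary one. -/
theorem untwist_linearWeight (hε : ε = 1 ∨ ε = -1) {N : ℕ} (D : ChordDiagram N) :
    untwist ε (linearWeight ε D) = (twistedFrame hε).weight D := by
  have hi := D.involutive
  rw [linearWeight, map_sum, LieFrame.weight, LieFrame.contract]
  symm
  refine sum_subset_zero_on_sdiff (fun φ hφ => ?_) (fun φ hφ => ?_) fun φ hφ => ?_
  · simpa using (LieFrame.mem_labellings.1 hφ).1
  -- Labellings with different labels at the ends of some chord vanish because `C` is diagonal.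
  · simp only [mem_sdiff, mem_filter, mem_univ, true_and, LieFrame.mem_labellings, not_and,
      not_forall] at hφ
    obtain ⟨x, hx⟩ := hφ.2 hφ.1
    have hxm : D.mate x ≠ x := fun e => hx (by rw [e])
    have : ∏ x with x < D.mate x, C ε (φ x) (φ (D.mate x)) = 0 := by
      rcases lt_or_gt_of_ne hxm with h | h
      · refine prod_eq_zero (i := D.mate x) (by simp [hi, h]) ?_
        rw [hi, C_apply_ne hε hx]
      · exact prod_eq_zero (i := x) (by simp [h]) (C_apply_ne hε (Ne.symm hx))
    rw [this, zero_mul, zero_smul, map_zero]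
  · obtain ⟨h0, hφ⟩ := LieFrame.mem_labellings.1 hφ
    have hw : word K N _ ((twistedFrame hε).letters D φ) =
        ((List.finRange N).map fun x => if D.mate x = x then 1 else Q ε (φ x)).prod ⊗ₜ[K]
          ((List.finRange N).map fun x => twist K (deg (φ x))).prod := by
      rw [word_apply, ← list_prod_tmul]
      congr 2
      ext1 x
      rw [LieFrame.letters]
      split_ifs with h
      -- The dummy label `0` has degree zero, so a point without chord contributes `1 ⊗ 1`.
      · rw [h0 x h]
        have : twist K (deg 0) = 1 := twist_zero
        rw [this]
        rfl
      · rfl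
    have hd : ∀ i, deg i + deg i = 0 := by decide
    -- Both ends of a chord have the same degree and degrees are 2-torsion, so the total degree is
    -- zero and the matrix is a multiple of `1`.
    have hs : ∑ x, deg (φ x) = 0 := by
      refine sum_involution (fun x _ => D.mate x) (fun x _ => by rw [hφ, hd])
        (fun x _ hx e => hx ?_) (fun _ _ => mem_univ _) fun x _ => hi x
      rw [h0 x e]; rfl
    rw [hw, list_prod_twist, hs, twist_zero, prod_cocycle D (fun x => deg (φ x))
      (fun x hx => by simp only [h0 x hx]; rfl) (fun x => by simp only [hφ]), map_smul,
      TensorProduct.tmul_smul, smul_smul]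
    have h1 : (twistedFrame hε).chordProd D φ * ∏ x with x < D.mate x,
        cocycle K (deg (φ x)) (deg (φ x)) = ∏ x with x < D.mate x, C ε (φ x) (φ (D.mate x)) := by
      rw [LieFrame.chordProd, ← prod_mul_distrib]
      refine prod_congr rfl fun x _ => ?_
      rw [hφ, C_apply_self hε]
      rfl
    rw [← mul_assoc, h1]
    have h2 : ∀ e : Fin N × Fin N, S K (φ (D.mate e.1)) (φ e.2) (φ e.2) (φ (D.mate e.1)) =
        commFactor K (deg (φ (D.mate e.1))) (deg (φ e.2)) := fun e => if_pos ⟨rfl, rfl⟩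
    simp only [h2]
    rfl

theorem recursion_linearWeight (hε : ε = 1 ∨ ε = -1) {N : ℕ} (D : ChordDiagram N) {a : Fin N}
    (ha : D.mate a ≠ a) : Recursion ε (linearWeight ε) (c ε) (c ε - y ε) D a := by
  have hz : c ε - y ε = Q ε 0 * Q ε 0 := by rw [y, sub_sub_cancel, sq]
  have h := (twistedFrame hε).recursion D ha
  unfold Recursion at h ⊢
  apply untwist_injective ε
  simp only [map_add, map_sub, map_smul, map_mul, map_sum, resolve, hz, untwist_H_sq hε,
    untwist_c hε, untwist_linearWeight hε]
  exact h

theorem recursion_w (hε : ε = 1 ∨ ε = -1) (p : ℕ) {N : ℕ} (D : ChordDiagram N) {a : Fin N}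
    (ha : D.mate a ≠ a) : Recursion ε (w ε p) (c ε) (c ε - y ε) D a :=
  Recursion.of_rotate (recursion_linearWeight hε _ (by
    rw [rotate_eq_conj, conj_mate]; exact fun e => ha ((finRotate N ^ p).injective e)))

theorem w_eq [CharZero K] (hε : ε = 1 ∨ ε = -1) (p : ℕ) {N : ℕ} (D : ChordDiagram N) (a : Fin N)
    (ha : D.mate a ≠ a) :
    w ε p D =
        (c ε - algebraMap K (U ε) (ε * ((D.crossing a).card : K))) * w ε p (D.erase a)
        + ε • ((c ε - y ε) *
            ∑ i ∈ D.crossing a, w ε p ((D.erase a).erase i))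
        + ε • ∑ i ∈ D.crossing a, ∑ j ∈ D.crossing a with i < j,
            (w ε p (((erase₃ D a i j).join i j).join (D.mate i) (D.mate j))
              - w ε p (((erase₃ D a i j).join i (D.mate j)).join (D.mate i) j))
        + ε • ((c ε - y ε) *
            ∑ i ∈ D.crossing a, ∑ j ∈ D.crossing a with i < j,
              (w ε p ((erase₃ D a i j).join i (D.mate j))
                + w ε p ((erase₃ D a i j).join (D.mate i) j)
                - w ε p ((erase₃ D a i j).join i j)
                - w ε p ((erase₃ D a i j).join (D.mate i) (D.mate j)))) := by
  have h := recursion_w hε p D ha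
  unfold Recursion at h
  rw [sum_ne_eq_two_nsmul _ _ fun i hi j hj hij => resolve_symm (w ε p) (c ε - y ε) hi hj hij,
    sum_sub_distrib, sum_const, ← mul_sum] at h
  simp only [resolve, sum_add_distrib, ← mul_sum] at h
  -- The recursion is known only after doubling; characteristic zero allows the factor `2` to be
  -- cancelled.
  refine smul_right_injective (U ε) (two_ne_zero (α := K)) ?_
  simp only
  rw [h, sub_mul (c ε) (algebraMap K (U ε) _), ← Algebra.smul_def]
  module

end A1

/-! ### Polynomiality in `c` and `y` -/

theorem ChordDiagram.join_mate_of_fixed {N : ℕ} (D : ChordDiagram N) {x y z : Fin N}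
    (hz : D.mate z = z) (hx : z ≠ x) (hy : z ≠ y) : (D.join x y).mate z = z := by
  change ((D.erase x).erase y).mate (Equiv.swap x y z) = z
  rw [Equiv.swap_apply_of_ne_of_ne hx hy]
  exact erase_mate_of_fixed _ _ _ (erase_mate_of_fixed _ _ _ hz)

namespace A1

open Finset Function ChordDiagram

variable {K : Type*} [Field K] {ε : K}

theorem commute_Q_zero (i : Fin 4) : Commute (Q ε 0) (Q ε i) := by
  have h := Q_mul_Q (ε := ε) 0 i
  have h1 : commFactor K (deg 0) (deg i) = 1 := by simp [commFactor, deg]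
  have h2 : ∀ k, bracket ε 0 i k = 0 := by
    intro k
    fin_cases i <;> fin_cases k <;> rfl
  rw [h1, one_smul, sum_eq_zero fun k _ => by rw [h2, zero_smul], add_zero] at h
  exact h

theorem commute_c_y : Commute (c ε) (y ε) := by
  have h : Commute (Q ε 0) (c ε) := by
    rw [c]
    exact Commute.sum_right _ _ _ fun i _ => Commute.sum_right _ _ _ fun j _ =>
      ((commute_Q_zero i).mul_right (commute_Q_zero j)).smul_right _
  exact (Commute.refl _).sub_right (h.symm.pow_right 2)

/-- The evaluation of polynomials in two variables at `c` and `y`. -/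
noncomputable def evalCY (ε : K) : MvPolynomial (Fin 2) K →ₗ[K] U ε :=
  (MvPolynomial.basisMonomials (Fin 2) K).constr K fun m => c ε ^ m 0 * y ε ^ m 1

theorem evalCY_monomial (m : Fin 2 →₀ ℕ) :
    evalCY ε (MvPolynomial.monomial m 1) = c ε ^ m 0 * y ε ^ m 1 := by
  have h := (MvPolynomial.basisMonomials (Fin 2) K).constr_basis K
    (fun m => c ε ^ m 0 * y ε ^ m 1) m
  rwa [MvPolynomial.coe_basisMonomials] at h

theorem evalCY_apply (P : MvPolynomial (Fin 2) K) :
    evalCY ε P = ∑ m ∈ P.support, P.coeff m • (c ε ^ m 0 * y ε ^ m 1) := by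
  conv_lhs => rw [← P.support_sum_monomial_coeff, map_sum]
  refine sum_congr rfl fun m _ => ?_
  rw [← evalCY_monomial, ← map_smul, MvPolynomial.smul_monomial, smul_eq_mul, mul_one]

/-- As `U ε` is not commutative, `evalCY` is only a linear map, and compatibility with
multiplication is checked on monomials. -/
theorem c_mul_mem_range {z : U ε} (hz : z ∈ LinearMap.range (evalCY ε)) :
    c ε * z ∈ LinearMap.range (evalCY ε) := by
  obtain ⟨P, rfl⟩ := hz
  have h : (evalCY ε).comp (LinearMap.mulLeft K (MvPolynomial.X 0)) =
      (LinearMap.mulLeft K (c ε)).comp (evalCY ε) := by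
    refine (MvPolynomial.basisMonomials (Fin 2) K).ext fun m => ?_
    simp only [MvPolynomial.coe_basisMonomials, LinearMap.comp_apply, LinearMap.mulLeft_apply,
      MvPolynomial.X, MvPolynomial.monomial_mul, mul_one, evalCY_monomial]
    simp [pow_add, mul_assoc]
  exact ⟨_, LinearMap.congr_fun h P⟩

theorem y_mul_mem_range {z : U ε} (hz : z ∈ LinearMap.range (evalCY ε)) :
    y ε * z ∈ LinearMap.range (evalCY ε) := by
  obtain ⟨P, rfl⟩ := hz
  have h : (evalCY ε).comp (LinearMap.mulLeft K (MvPolynomial.X 1)) =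
      (LinearMap.mulLeft K (y ε)).comp (evalCY ε) := by
    refine (MvPolynomial.basisMonomials (Fin 2) K).ext fun m => ?_
    simp only [MvPolynomial.coe_basisMonomials, LinearMap.comp_apply, LinearMap.mulLeft_apply,
      MvPolynomial.X, MvPolynomial.monomial_mul, mul_one, evalCY_monomial]
    -- Here `y` has to pass the power of `c`, which uses that the two commute.
    rw [← mul_assoc, ← (commute_c_y.pow_left (m 0)).eq, mul_assoc]
    simp [pow_add]
  exact ⟨_, LinearMap.congr_fun h P⟩

theorem linearWeight_of_mate_eq_id {N : ℕ} (D : ChordDiagram N) (h : ∀ x, D.mate x = x) :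
    linearWeight ε D = 1 := by
  rw [linearWeight, sum_eq_single 0]
  · simp [h, S, commFactor, deg]
  · intro φ hφ hne
    exact absurd (funext fun x => (mem_filter.1 hφ).2 x (h x)) hne
  · simp

/-- Surgery creates chords only between ends of the crossing chords, so no term on the right uses
`a` or a point that was free in `D`. -/
theorem Recursion.mem {R : Type*} [Ring R] [Algebra K R] [CharZero K] {N : ℕ}
    {W : ChordDiagram N → R} {c z : R} {D : ChordDiagram N} {a : Fin N}
    (h : Recursion ε W c z D a) (M : Submodule K R) (hc : ∀ u ∈ M, c * u ∈ M)
    (hz : ∀ u ∈ M, z * u ∈ M)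
    (hW : ∀ E : ChordDiagram N, (∀ x, D.mate x = x ∨ x = a → E.mate x = x) → W E ∈ M) :
    W D ∈ M := by
  have h0 : ∀ x, D.mate x = x ∨ x = a → (D.erase a).mate x = x := by
    rintro x (hx | rfl)
    · exact erase_mate_of_fixed _ _ _ hx
    · exact erase_mate_self _ _
  have h2 : (2 : K) • W D ∈ M := by
    rw [h]
    refine add_mem (sub_mem (M.smul_mem _ (hc _ (hW _ h0))) (M.smul_mem _ (sum_mem fun i _ =>
      sub_mem (hW _ h0) (hz _ (hW _ fun x hx => erase_mate_of_fixed _ _ _ (h0 x hx))))))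
      (M.smul_mem _ (sum_mem fun i hi => sum_mem fun j hj => ?_))
    have hj := (mem_filter.1 hj).1
    have h3 : ∀ x, D.mate x = x ∨ x = a → (erase₃ D a i j).mate x = x := fun x hx =>
      erase_mate_of_fixed _ _ _ (erase_mate_of_fixed _ _ _ (h0 x hx))
    have hne : ∀ k ∈ D.crossing a, ∀ x, D.mate x = x ∨ x = a → x ≠ k ∧ x ≠ D.mate k := by
      intro k hk x hx
      obtain ⟨n1, n2⟩ := ne_of_mem_crossing hk
      rcases hx with hx | rfl
      · refine ⟨fun e => n1 (e ▸ hx), fun e => n1 ?_⟩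
        rw [e, D.involutive] at hx
        exact hx.symm
      · exact ⟨n2.ne.symm, n2.symm.ne_mate⟩
    have g := fun x hx => And.intro (hne i hi x hx) (hne j hj x hx)
    refine add_mem (sub_mem (hW _ fun x hx => ?_) (hW _ fun x hx => ?_)) (hz _ (sub_mem (sub_mem
      (add_mem (hW _ fun x hx => ?_) (hW _ fun x hx => ?_)) (hW _ fun x hx => ?_))
      (hW _ fun x hx => ?_)))
    · exact join_mate_of_fixed _ (join_mate_of_fixed _ (h3 x hx) (g x hx).1.1 (g x hx).2.1)
        (g x hx).1.2 (g x hx).2.2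
    · exact join_mate_of_fixed _ (join_mate_of_fixed _ (h3 x hx) (g x hx).1.1 (g x hx).2.2)
        (g x hx).1.2 (g x hx).2.1
    · exact join_mate_of_fixed _ (h3 x hx) (g x hx).1.1 (g x hx).2.2
    · exact join_mate_of_fixed _ (h3 x hx) (g x hx).1.2 (g x hx).2.1
    · exact join_mate_of_fixed _ (h3 x hx) (g x hx).1.1 (g x hx).2.1
    · exact join_mate_of_fixed _ (h3 x hx) (g x hx).1.2 (g x hx).2.2
  have := M.smul_mem (2 : K)⁻¹ h2
  rwa [smul_smul, inv_mul_cancel₀ two_ne_zero, one_smul] at this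

theorem w_mem_range [CharZero K] (hε : ε = 1 ∨ ε = -1) (p : ℕ) {N : ℕ} (D : ChordDiagram N) :
    w ε p D ∈ LinearMap.range (evalCY ε) := by
  -- The support of `mate` is the set of chord ends; it shrinks strictly because `a` leaves it.
  induction hn : #D.mate.support using Nat.strong_induction_on generalizing D with
  | _ n ih =>
  by_cases h : ∃ a, D.mate a ≠ a
  · obtain ⟨a, ha⟩ := h
    refine (recursion_w hε p D ha).mem _ (fun _ => c_mul_mem_range) (fun u hu => ?_)
      fun E hE => ih _ ?_ E rfl
    · rw [sub_mul]
      exact sub_mem (c_mul_mem_range hu) (y_mul_mem_range hu)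
    · rw [← hn]
      refine card_lt_card (Finset.ssubset_iff_subset_ne.2 ⟨fun x hx => ?_, fun e => ?_⟩)
      · rw [Equiv.Perm.mem_support] at hx ⊢
        exact fun e => hx (hE x (Or.inl e))
      · have : a ∈ E.mate.support := e ▸ Equiv.Perm.mem_support.2 ha
        exact Equiv.Perm.mem_support.1 this (hE a (Or.inr rfl))
  · push Not at h
    refine ⟨MvPolynomial.monomial 0 1, ?_⟩
    rw [evalCY_monomial, w, linearWeight_of_mate_eq_id]
    · simp
    · intro x
      obtain ⟨x, rfl⟩ := (finRotate N ^ p).surjective x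
      rw [rotate_eq_conj, conj_mate, h]

end A1

theorem mainTheorem1 {K : Type*} [Field K] [CharZero K] (ε : K) (hε : ε = 1 ∨ ε = -1)
    {N : ℕ} (D : ChordDiagram N) (p : ℕ) :
    (∃ P : MvPolynomial (Fin 2) K,
      A1.w ε p D = ∑ m ∈ P.support, P.coeff m • (A1.c ε ^ m 0 * A1.y ε ^ m 1)) ∧
    ∀ a : Fin N, D.mate a ≠ a →
      A1.w ε p D =
        (A1.c ε - algebraMap K (A1.U ε) (ε * ((D.crossing a).card : K))) * A1.w ε p (D.erase a)
        + ε • ((A1.c ε - A1.y ε) *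
            ∑ i ∈ D.crossing a, A1.w ε p ((D.erase a).erase i))
        + ε • ∑ i ∈ D.crossing a, ∑ j ∈ D.crossing a with i < j,
            (A1.w ε p (((A1.erase₃ D a i j).join i j).join (D.mate i) (D.mate j))
              - A1.w ε p (((A1.erase₃ D a i j).join i (D.mate j)).join (D.mate i) j))
        + ε • ((A1.c ε - A1.y ε) *
            ∑ i ∈ D.crossing a, ∑ j ∈ D.crossing a with i < j,
              (A1.w ε p ((A1.erase₃ D a i j).join i (D.mate j))
                + A1.w ε p ((A1.erase₃ D a i j).join (D.mate i) j)
                - A1.w ε p ((A1.erase₃ D a i j).join i j)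
                - A1.w ε p ((A1.erase₃ D a i j).join (D.mate i) (D.mate j)))) := by
  obtain ⟨P, hP⟩ := A1.w_mem_range hε p D
  exact ⟨⟨P, by rw [← hP, A1.evalCY_apply]⟩, fun a ha => A1.w_eq hε p D a ha⟩
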